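/- Let $b_1,b_2>0$, $0<x_2<1$, and let $k\ge 1$ be an integer. Let $a_k:\mathbb R\to(0,\infty)$ be given by $a_k(x)=b_2^{-2}$ if $x\in[j,j+x_2)$ for some $j\in\{0,\dots,k-1\}$, and $a_k(x)=b_1^{-2}$ otherwise. Let $P_k=-\partial_x a_k\partial_x$ on $L^2(\mathbb R)$ with domain $\{u\in H^1(\mathbb R): a_k u'\in H^1(\mathbb R)\}$. Put $\mathbb C_\pm=\{\lambda\in\mathbb C:\pm\operatorname{Im}\lambda>0\}$. The resolvent $(P_k-\lambda^2)^{-1}$, $\lambda\in\mathbb C_+$, extends meromorphically to $\lambda\in\mathbb C$ as a family of operators $L^2_{\rm comp}(\mathbb R)\to L^2_{\rm loc}(\mathbb R)$ (that is, for every $N$ the operator-valued function $1_{[-N,N]}(P_k-\lambda^2)^{-1}1_{[-N,N]}$ extends meromorphically to $\mathbb C$); its poles in $\mathbb C_-$ (the poles of these extensions, for some $N$) are the resonances of $P_k$, and ${\rm Res}(P_k)$ denotes the set of them. For $\lambda\neq0$, $\operatorname{Im}\lambda\ge0$, the reflection coefficient $r_k(\lambda)$ is the unique $r\in\mathbb C$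 for which there are $t\in\mathbb C$ and a solution $\psi$ (with $\psi,a_k\psi'\in H^1_{\rm loc}(\mathbb R)$) of $-(a_k\psi')'=\lambda^2\psi$ such that $\psi(x)=e^{i\lambda b_1x}+r\,e^{-i\lambda b_1x}$ for $x<0$ and $\psi(x)=t\,e^{i\lambda b_1x}$ for $x>k$. For $m\ge1$ let $\beta_m=b_1$ if $m$ is odd and $\beta_m=b_2$ if $m$ is even, and let $\xi_{2j+1}=j$, $\xi_{2j}=j-1+x_2$. Define $\det D_n=\det D_n(-i\lambda)$ and $\det\widetilde D_n=\det\widetilde D_n(-i\lambda)$ by $\det D_2=(\beta_1+\beta_2)e^{i\lambda\xi_1(\beta_2-\beta_1)}$, $\det\widetilde D_2=(\beta_2-\beta_1)e^{-i\lambda\xi_1(\beta_1+\beta_2)}$ and, for $n\ge3$, $$\det D_n=e^{i\lambda \beta_n\xi_{n-1}}\big[(\beta_{n-1}-\beta_n)e^{i\lambda \beta_{n-1}\xi_{n-1}}\det\widetilde D_{n-1}-(\beta_{n-1}+\beta_n)e^{-i\lambda \beta_{n-1}\xi_{n-1}}\det D_{n-1}\big],$$ $$\det\widetilde D_n=e^{-i\lambda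 \beta_n\xi_{n-1}}\big[(\beta_{n-1}-\beta_n)e^{-i\lambda \beta_{n-1}\xi_{n-1}}\det D_{n-1}-(\beta_{n-1}+\beta_n)e^{i\lambda \beta_{n-1}\xi_{n-1}}\det\widetilde D_{n-1}\big].$$ Let $Q_m(-i\lambda)=e^{2i\lambda \beta_m\xi_m}\,\det\widetilde D_m/\det D_m$ and $d=(b_2-b_1)/(b_2+b_1)$. Then $r_k$ is well defined for $\lambda\ne 0$, $\operatorname{Im}\lambda\ge0$, and extends to a meromorphic function on $\mathbb C$ that is analytic on $\{\operatorname{Im}\lambda\ge0\}$ and on $\mathbb C_-\setminus{\rm Res}(P_k)$, and whose poles in $\mathbb C_-$ are exactly the points of ${\rm Res}(P_k)$. Moreover, for $\lambda\in\mathbb C_-$, $$\lambda\in{\rm Res}(P_k)\iff\det D_{2k+1}(-i\lambda)=0,$$ and, if $b_1\neq b_2$, this is also equivalent to $\det D_{2k}(-i\lambda)\ne0$ and $Q_{2k}(-i\lambda)=1/d$. Finally $$r_k(\lambda)=-\frac{-d+Q_{2k}(-i\lambda)}{1-d\,Q_{2k}(-i\lambda)}$$ for every $\lambda\in\mathbb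 C$ with $\det D_{2k}(-i\lambda)\neq0$ and $1-d\,Q_{2k}(-i\lambda)\neq0$. -/

import Mathlib

noncomputable section

namespace FinitePeriodic

open MeasureTheory Complex

open scoped ContDiff

/-- The complex Hilbert space `L²(ℝ)`. -/
abbrev L2 : Type := Lp ℂ 2 (volume : Measure ℝ)

/-- `g` is the weak (distributional) derivative of `f` on the real line. -/
def HasWeakDeriv (f g : ℝ → ℂ) : Prop :=
  LocallyIntegrable f ∧ LocallyIntegrable g ∧
    ∀ φ : ℝ → ℝ, ContDiff ℝ ∞ φ → HasCompactSupport φ →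
      ∫ x, deriv φ x • f x = -∫ x, φ x • g x

/-- `f ∈ L²_loc(ℝ)`. -/
def MemL2Loc (f : ℝ → ℂ) : Prop :=
  ∀ K : Set ℝ, IsCompact K → MemLp f 2 (volume.restrict K)

/-- `f ∈ H¹_loc(ℝ)` with weak derivative `g`. -/
def HasH1LocDeriv (f g : ℝ → ℂ) : Prop :=
  MemL2Loc f ∧ MemL2Loc g ∧ HasWeakDeriv f g

/-! ### The operator `P_k = -∂ₓ a_k ∂ₓ` -/

/-- The unit cell: `b₂⁻²` on `[0, x₂)` and `b₁⁻²` on `[x₂, 1)`. -/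
def unitCell (b₁ b₂ x₂ : ℝ) (y : ℝ) : ℝ :=
  if y < x₂ then (b₂ ^ 2)⁻¹ else (b₁ ^ 2)⁻¹

/-- The coefficient `a_k`: `k` copies of the unit cell on `[0, k)`, and `b₁⁻²` elsewhere. -/
def coeff (b₁ b₂ x₂ : ℝ) (k : ℕ) (x : ℝ) : ℝ :=
  if 0 ≤ x ∧ x < k then unitCell b₁ b₂ x₂ (Int.fract x) else (b₁ ^ 2)⁻¹

/-- The graph of `P_k`: `u ∈ H¹(ℝ)`, `a_k u' ∈ H¹(ℝ)` and `P_k u = -(a_k u')' = f`.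
Membership of `a_k u'` in `L²` is automatic since `a_k` is bounded. -/
def OperatorGraph (b₁ b₂ x₂ : ℝ) (k : ℕ) (u f : L2) : Prop :=
  ∃ w : L2, HasWeakDeriv u w ∧
    HasWeakDeriv (fun x => (coeff b₁ b₂ x₂ k x : ℂ) * w x) (fun x => -f x)

/-- `R = (P_k - z²)⁻¹` as a bounded operator on `L²(ℝ)`: for every `v`, the vector `R v` is the
unique `u` in the domain of `P_k` with `P_k u = z² u + v`. -/
def IsResolventAt (b₁ b₂ x₂ : ℝ) (k : ℕ) (z : ℂ) (R : L2 →L[ℂ] L2) : Prop :=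
  ∀ u v : L2, R v = u ↔ OperatorGraph b₁ b₂ x₂ k u (z ^ 2 • u + v)

/-- The class of `1_{[-N,N]} u` in `L²(ℝ)`. -/
def cutoffFun (N : ℝ) (u : L2) : L2 :=
  ((Lp.memLp u).indicator (measurableSet_Icc (a := -N) (b := N))).toLp _

theorem cutoffFun_coeFn (N : ℝ) (u : L2) :
    ∀ᵐ x : ℝ, cutoffFun N u x = (Set.Icc (-N) N).indicator (fun y => u y) x :=
  MemLp.coeFn_toLp _

theorem cutoffFun_add (N : ℝ) (u v : L2) :
    cutoffFun N (u + v) = cutoffFun N u + cutoffFun N v := by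
  apply Lp.ext
  filter_upwards [cutoffFun_coeFn N (u + v), cutoffFun_coeFn N u, cutoffFun_coeFn N v,
    Lp.coeFn_add u v, Lp.coeFn_add (cutoffFun N u) (cutoffFun N v)] with x h1 h2 h3 h4 h5
  rw [h1, h5, Pi.add_apply, h2, h3]
  by_cases hx : x ∈ Set.Icc (-N) N
  · rw [Set.indicator_of_mem hx, Set.indicator_of_mem hx, Set.indicator_of_mem hx, h4,
      Pi.add_apply]
  · rw [Set.indicator_of_notMem hx, Set.indicator_of_notMem hx, Set.indicator_of_notMem hx,
      add_zero]

theorem cutoffFun_smul (N : ℝ) (c : ℂ) (u : L2) :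
    cutoffFun N (c • u) = c • cutoffFun N u := by
  apply Lp.ext
  filter_upwards [cutoffFun_coeFn N (c • u), cutoffFun_coeFn N u,
    Lp.coeFn_smul c u, Lp.coeFn_smul c (cutoffFun N u)] with x h1 h2 h3 h4
  rw [h1, h4, Pi.smul_apply, h2]
  by_cases hx : x ∈ Set.Icc (-N) N
  · rw [Set.indicator_of_mem hx, Set.indicator_of_mem hx, h3, Pi.smul_apply]
  · rw [Set.indicator_of_notMem hx, Set.indicator_of_notMem hx, smul_zero]

theorem norm_cutoffFun_le (N : ℝ) (u : L2) : ‖cutoffFun N u‖ ≤ 1 * ‖u‖ := by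
  rw [one_mul]
  apply Lp.norm_le_norm_of_ae_le
  filter_upwards [cutoffFun_coeFn N u] with x hx
  rw [hx]
  exact norm_indicator_le_norm_self _ _

/-- Multiplication by the indicator function of `[-N, N]` as a bounded operator on `L²(ℝ)`. -/
def cutoff (N : ℝ) : L2 →L[ℂ] L2 :=
  LinearMap.mkContinuous
    { toFun := cutoffFun N
      map_add' := cutoffFun_add N
      map_smul' := cutoffFun_smul N }
    1 (norm_cutoffFun_le N)

/-- `A` is the meromorphic continuation to `ℂ` of the cut-off resolvent
`1_{[-N,N]} (P_k - z²)⁻¹ 1_{[-N,N]}`, `Im z > 0`, as a function with values in the bounded operators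
on `L²(ℝ)`. The continuation of the resolvent as a family of operators from `L²_comp` to `L²_loc`
is the collection of these continuations for all `N`. -/
def IsCutoffResolventContinuation (b₁ b₂ x₂ : ℝ) (k : ℕ) (N : ℝ) (A : ℂ → L2 →L[ℂ] L2) : Prop :=
  MeromorphicOn A Set.univ ∧
    ∀ z : ℂ, 0 < z.im → ∃ R : L2 →L[ℂ] L2, IsResolventAt b₁ b₂ x₂ k z R ∧
      A z = (cutoff N).comp (R.comp (cutoff N))

/-- `Res(P_k)`: the poles in the open lower half-plane of the meromorphic continuation of the
resolvent `(P_k - z²)⁻¹ : L²_comp → L²_loc`. -/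
def resonances (b₁ b₂ x₂ : ℝ) (k : ℕ) : Set ℂ :=
  {z | z.im < 0 ∧ ∃ (N : ℝ) (A : ℂ → L2 →L[ℂ] L2),
    IsCutoffResolventContinuation b₁ b₂ x₂ k N A ∧ meromorphicOrderAt A z < 0}

/-! ### The reflection coefficient -/

/-- `ρ` is a reflection coefficient of `P_k` at frequency `z`: some solution
`ψ ∈ H¹_loc`, `a_k ψ' ∈ H¹_loc` of `P_k ψ = z² ψ` equals `e^{i z b₁ x} + ρ e^{-i z b₁ x}` for `x < 0`
and `τ e^{i z b₁ x}` for `x > k`. -/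
def IsReflectionCoefficient (b₁ b₂ x₂ : ℝ) (k : ℕ) (z ρ : ℂ) : Prop :=
  ∃ (ψ w : ℝ → ℂ) (τ : ℂ),
    HasH1LocDeriv ψ w ∧
    HasH1LocDeriv (fun x => (coeff b₁ b₂ x₂ k x : ℂ) * w x) (fun x => -(z ^ 2 * ψ x)) ∧
    (∀ x : ℝ, x < 0 → ψ x = exp (I * z * b₁ * x) + ρ * exp (-(I * z * b₁ * x))) ∧
    (∀ x : ℝ, (k : ℝ) < x → ψ x = τ * exp (I * z * b₁ * x))

/-! ### The determinants `det D_n`, `det D̃_n` and the functions `Q_m` -/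

/-- The pair `(det D_n(s), det D̃_n(s))` attached to a step function with values `b_j⁻²` on
`(x_{j-1}, x_j)`, given by the recursion in `n ≥ 2`; here `s = -iλ`. The values at `n = 0, 1` are
irrelevant. -/
def detPair (b x : ℕ → ℝ) (s : ℂ) : ℕ → ℂ × ℂ
  | 0 => 0
  | 1 => 0
  | 2 => ((b 1 + b 2) * exp (-s * x 1 * (b 2 - b 1)),
      (b 2 - b 1) * exp (s * x 1 * (b 1 + b 2)))
  | (m + 3) =>
    let D := (detPair b x s (m + 2)).1
    let D' := (detPair b x s (m + 2)).2
    (exp (-s * b (m + 3) * x (m + 2)) *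
        ((b (m + 2) - b (m + 3)) * exp (-s * b (m + 2) * x (m + 2)) * D' -
          (b (m + 2) + b (m + 3)) * exp (s * b (m + 2) * x (m + 2)) * D),
      exp (s * b (m + 3) * x (m + 2)) *
        ((b (m + 2) - b (m + 3)) * exp (s * b (m + 2) * x (m + 2)) * D -
          (b (m + 2) + b (m + 3)) * exp (-s * b (m + 2) * x (m + 2)) * D'))

/-- `b₁ = b₃ = b₅ = …` and `b₂ = b₄ = …`. -/
def layerB (b₁ b₂ : ℝ) (m : ℕ) : ℝ := if Odd m then b₁ else b₂

/-- The interfaces `x_{2j+1} = j` and `x_{2j} = j - 1 + x₂`. -/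
def layerX (x₂ : ℝ) (m : ℕ) : ℝ := if Odd m then ((m : ℝ) - 1) / 2 else (m : ℝ) / 2 - 1 + x₂

/-- `det D_n(s)` for the finite periodic medium. -/
def detD (b₁ b₂ x₂ : ℝ) (n : ℕ) (s : ℂ) : ℂ :=
  (detPair (layerB b₁ b₂) (layerX x₂) s n).1

/-- `det D̃_n(s)` for the finite periodic medium. -/
def detDtilde (b₁ b₂ x₂ : ℝ) (n : ℕ) (s : ℂ) : ℂ :=
  (detPair (layerB b₁ b₂) (layerX x₂) s n).2

/-- `Q_m(s) = e^{-2 s b_m x_m} det D̃_m(s) / det D_m(s)`; meaningful where `det D_m(s) ≠ 0`. -/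
def Q (b₁ b₂ x₂ : ℝ) (m : ℕ) (s : ℂ) : ℂ :=
  exp (-2 * s * layerB b₁ b₂ m * layerX x₂ m) *
    (detDtilde b₁ b₂ x₂ m s / detD b₁ b₂ x₂ m s)

/-- `d = (b₂ - b₁) / (b₂ + b₁)`. -/
def dCoeff (b₁ b₂ : ℝ) : ℝ := (b₂ - b₁) / (b₂ + b₁)

end FinitePeriodic

end

/-!
Write `s = -i z`, so that the equation reads `(a ψ')' = s² ψ`. The recursion for
`(det D_n, det D̃_n)` is, up to normalization, the transfer of the pair (wave decaying to the left,
wave decaying to the right) across one interface, started from the Jost solution `e^{s b₁ y}` on the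
left half-line. As the medium is symmetric, the Jost solution on the right is the mirror image of
this one, and the Wronskian `W(s)` of the two is `s det D_{2k+1}(s)` times a nowhere vanishing
entire function. For `Re s > 0` the resolvent has the integral kernel `-W(s)⁻¹ ψ_R(x) ψ_L(y)`,
`y ≤ x` (and symmetrically). Cut off to `[-N, N]`, the product of the Jost solutions defines an
entire family of operators, nowhere zero for large `N`, so that for `Re s < 0` the continued
resolvent has a pole exactly where `W` vanishes. On the left of the medium `ψ_R` is a combination
of the incoming and the reflected wave with amplitudes proportional to `det D_{2k+1}` and
`det D̃_{2k+1}`. These never vanish simultaneously, so the poles of their quotient are the zeros of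
`det D_{2k+1}`. Finally, the wave decaying to the right is strictly smaller than the other one,
layer by layer, when `Re s ≥ 0`; hence `det D_{2k+1}` has no zero there.
-/

noncomputable section

namespace FinitePeriodic

open MeasureTheory Complex Set Filter

open scoped ContDiff Topology

/-! ### Primitives and weak derivatives -/

theorem intervalIntegrable_of_locallyIntegrable {g : ℝ → ℂ} (hg : LocallyIntegrable g) (a b : ℝ) :
    IntervalIntegrable g volume a b :=
  intervalIntegrable_iff.2 ((hg.integrableOn_isCompact isCompact_uIcc).mono_set uIoc_subset_uIcc)

theorem locallyIntegrable_continuous_mul {f g : ℝ → ℂ} (hf : Continuous f)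
    (hg : LocallyIntegrable g) : LocallyIntegrable fun x => f x * g x := by
  rw [← locallyIntegrableOn_univ] at hg ⊢
  exact hg.continuousOn_mul hf.continuousOn isOpen_univ.isLocallyClosed

theorem locallyIntegrable_ite_lt {g G : ℝ → ℂ} (hg : LocallyIntegrable g)
    (hG : LocallyIntegrable G) (c : ℝ) : LocallyIntegrable fun x => if x < c then g x else G x := by
  have hsum := (hg.indicator (measurableSet_Iio (a := c))).add
    (hG.indicator (measurableSet_Iio (a := c)).compl)
  refine hsum.congr (.of_forall fun x => ?_)
  by_cases hx : x < c <;> simp [hx, not_lt.1, indicator]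

theorem absolutelyContinuousOnInterval_intervalIntegral {g : ℝ → ℂ} (hg : LocallyIntegrable g)
    (a b : ℝ) : AbsolutelyContinuousOnInterval (fun x => ∫ t in a..x, g t) a b := by
  have const (c : ℂ) : AbsolutelyContinuousOnInterval (fun _ : ℝ => c) a b :=
    (LipschitzWith.const c).lipschitzOnWith.absolutelyContinuousOnInterval
  have hInt := intervalIntegrable_of_locallyIntegrable hg a
  have hre (x : ℝ) : IntervalIntegrable (fun t => (g t).re) volume a x :=
    ⟨(hInt x).1.re, (hInt x).2.re⟩
  have him (x : ℝ) : IntervalIntegrable (fun t => (g t).im) volume a x :=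
    ⟨(hInt x).1.im, (hInt x).2.im⟩
  have hsum := (((hre b).absolutelyContinuousOnInterval_intervalIntegral left_mem_uIcc).fun_smul
    (const 1)).fun_add (((him b).absolutelyContinuousOnInterval_intervalIntegral
      left_mem_uIcc).fun_smul (const I))
  refine (congrArg (AbsolutelyContinuousOnInterval · a b) (funext fun x => ?_)).mp hsum
  rw [← intervalIntegral.integral_smul_const, ← intervalIntegral.integral_smul_const,
    ← intervalIntegral.integral_add ⟨(hre x).1.smul_const 1, (hre x).2.smul_const 1⟩
      ⟨(him x).1.smul_const I, (him x).2.smul_const I⟩]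
  simp only [real_smul, mul_one, re_add_im]

/-- `f` is an absolutely continuous function whose almost everywhere derivative is the locally
integrable function `g`, encoded by the fundamental theorem of calculus based at `0`. -/
structure IsPrimitive (f g : ℝ → ℂ) : Prop where
  locallyIntegrable : LocallyIntegrable g
  eq_add_integral : ∀ x, f x = f 0 + ∫ t in (0 : ℝ)..x, g t

namespace IsPrimitive

variable {f g F G : ℝ → ℂ}

theorem intervalIntegrable (h : IsPrimitive f g) (a b : ℝ) : IntervalIntegrable g volume a b :=
  intervalIntegrable_of_locallyIntegrable h.locallyIntegrable a b

theorem sub_eq (h : IsPrimitive f g) (a b : ℝ) : f b - f a = ∫ t in a..b, g t := by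
  rw [h.eq_add_integral b, h.eq_add_integral a, add_sub_add_left_eq_sub,
    intervalIntegral.integral_interval_sub_left (h.intervalIntegrable _ _)
      (h.intervalIntegrable _ _)]

theorem of_sub_eq (hg : LocallyIntegrable g) (c : ℝ)
    (h : ∀ x, f x - f c = ∫ t in c..x, g t) : IsPrimitive f g := by
  refine ⟨hg, fun x => ?_⟩
  rw [← intervalIntegral.integral_interval_sub_left
    (intervalIntegrable_of_locallyIntegrable hg c x)
    (intervalIntegrable_of_locallyIntegrable hg c 0), ← h, ← h]
  ring

theorem of_hasDerivAt (hf : ∀ x, HasDerivAt f (g x) x) (hg : Continuous g) : IsPrimitive f g :=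
  of_sub_eq hg.locallyIntegrable 0 fun _ =>
    (intervalIntegral.integral_eq_sub_of_hasDerivAt (fun x _ => hf x)
      (hg.intervalIntegrable _ _)).symm

theorem continuous (h : IsPrimitive f g) : Continuous f := by
  rw [funext h.eq_add_integral]
  exact continuous_const.add (intervalIntegral.continuous_primitive h.intervalIntegrable 0)

theorem congr_ae (h : IsPrimitive f g) (hg : g =ᵐ[volume] G) : IsPrimitive f G :=
  of_sub_eq (h.locallyIntegrable.congr hg) 0 fun x =>
    (h.sub_eq 0 x).trans (intervalIntegral.integral_congr_ae (hg.mono fun _ hx _ => hx))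

theorem ae_hasDerivAt (h : IsPrimitive f g) : ∀ᵐ x, HasDerivAt f (g x) x := by
  filter_upwards [LocallyIntegrable.ae_hasDerivAt_integral h.locallyIntegrable] with x hx
  rw [funext h.eq_add_integral]
  exact (hx 0).const_add _

theorem eq_of_zero (h : IsPrimitive f fun _ => 0) (x y : ℝ) : f x = f y := by
  rw [← sub_eq_zero, h.sub_eq, intervalIntegral.integral_zero]

theorem add (h : IsPrimitive f g) (H : IsPrimitive F G) :
    IsPrimitive (fun x => f x + F x) (fun x => g x + G x) :=
  of_sub_eq (h.locallyIntegrable.add H.locallyIntegrable) 0 fun x => by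
    rw [intervalIntegral.integral_add (h.intervalIntegrable _ _) (H.intervalIntegrable _ _),
      ← h.sub_eq, ← H.sub_eq, add_sub_add_comm]

theorem const_mul (c : ℂ) (h : IsPrimitive f g) :
    IsPrimitive (fun x => c * f x) (fun x => c * g x) :=
  of_sub_eq (h.locallyIntegrable.smul c) 0 fun x => by
    rw [intervalIntegral.integral_const_mul, ← h.sub_eq, mul_sub]

theorem sub (h : IsPrimitive f g) (H : IsPrimitive F G) :
    IsPrimitive (fun x => f x - F x) (fun x => g x - G x) := by
  simpa only [neg_one_mul, ← sub_eq_add_neg] using h.add (H.const_mul (-1))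

theorem absolutelyContinuous (h : IsPrimitive f g) (a b : ℝ) :
    AbsolutelyContinuousOnInterval f a b := by
  have hf : f = fun x => f a + ∫ t in a..x, g t := funext fun x => by rw [← h.sub_eq]; ring
  rw [hf]
  exact (LipschitzWith.const (f a)).lipschitzOnWith.absolutelyContinuousOnInterval.fun_add
    (absolutelyContinuousOnInterval_intervalIntegral h.locallyIntegrable a b)

theorem mul (h : IsPrimitive f g) (H : IsPrimitive F G) :
    IsPrimitive (fun x => f x * F x) (fun x => f x * G x + F x * g x) := by
  have hInt : LocallyIntegrable fun x => f x * G x + F x * g x :=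
    (locallyIntegrable_continuous_mul h.continuous H.locallyIntegrable).add
      (locallyIntegrable_continuous_mul H.continuous h.locallyIntegrable)
  have hP : IsPrimitive (fun x => ∫ t in (0 : ℝ)..x, (f t * G t + F t * g t))
      (fun x => f x * G x + F x * g x) := ⟨hInt, fun x => by simp⟩
  refine of_sub_eq hInt 0 fun x => ?_
  have hac := ((h.absolutelyContinuous 0 x).fun_smul (H.absolutelyContinuous 0 x)).fun_sub
    (hP.absolutelyContinuous 0 x)
  have hder : ∀ᵐ y, y ∈ uIcc 0 x → HasDerivAt
      (fun y => f y • F y - ∫ t in (0 : ℝ)..y, (f t * G t + F t * g t)) 0 y := by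
    filter_upwards [h.ae_hasDerivAt, H.ae_hasDerivAt, hP.ae_hasDerivAt] with y hf hF hfF _
    exact ((hf.mul hF).sub hfF).congr_deriv (by ring)
  obtain ⟨C, hC⟩ := hac.const_of_ae_hasDerivAt_zero hder
  have h₀ := hC 0 left_mem_uIcc
  have hx := hC x right_mem_uIcc
  simp only [smul_eq_mul, intervalIntegral.integral_same, sub_zero] at h₀ hx
  rw [h₀, ← hx, sub_sub_cancel]

theorem glue (h : IsPrimitive f g) (H : IsPrimitive F G) {c : ℝ} (hc : f c = F c) :
    IsPrimitive (fun x => if x < c then f x else F x) (fun x => if x < c then g x else G x) := by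
  refine of_sub_eq (locallyIntegrable_ite_lt h.locallyIntegrable H.locallyIntegrable c) c
    fun x => ?_
  rcases lt_or_ge x c with hx | hx
  · rw [if_pos hx, if_neg (lt_irrefl c), ← hc, h.sub_eq]
    refine intervalIntegral.integral_congr_ae ?_
    filter_upwards [compl_mem_ae_iff.2 (measure_singleton c)] with y hy hyx
    rw [uIoc_of_ge hx.le] at hyx
    rw [if_pos (lt_of_le_of_ne hyx.2 hy)]
  · rw [if_neg hx.not_gt, if_neg (lt_irrefl c), H.sub_eq]
    refine intervalIntegral.integral_congr_ae (Eventually.of_forall fun y hyx => ?_)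
    rw [uIoc_of_le hx] at hyx
    rw [if_neg hyx.1.not_gt]

theorem comp_sub_left (h : IsPrimitive f g) (L : ℝ) :
    IsPrimitive (fun x => f (L - x)) (fun x => -g (L - x)) := by
  have hg : LocallyIntegrable fun x => g (L - x) := by
    have := (locallyIntegrable_map_homeomorph (Homeomorph.subLeft L) (f := g)
      (μ := volume)).1
    rw [Homeomorph.coe_subLeft, (volume.measurePreserving_sub_left L).map_eq] at this
    exact this h.locallyIntegrable
  refine of_sub_eq hg.neg 0 fun x => ?_
  rw [intervalIntegral.integral_neg, intervalIntegral.integral_comp_sub_left (fun y => g y) L,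
    ← h.sub_eq, sub_zero, neg_sub]

theorem integral_eq_zero (h : IsPrimitive f g) (hg : Integrable g) (hf : HasCompactSupport f) :
    ∫ x, g x = 0 := by
  rw [hasCompactSupport_iff_eventuallyEq, coclosedCompact_eq_cocompact,
    cocompact_eq_atBot_atTop, EventuallyEq, eventually_sup] at hf
  refine tendsto_nhds_unique (intervalIntegral_tendsto_integral hg tendsto_neg_atTop_atBot
    tendsto_id) (tendsto_const_nhds.congr' ?_)
  filter_upwards [tendsto_neg_atTop_atBot.eventually hf.1, hf.2] with x hneg hpos
  rw [← h.sub_eq, id, hpos, hneg, Pi.zero_apply, Pi.zero_apply, sub_self]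

theorem hasWeakDeriv (h : IsPrimitive f g) : HasWeakDeriv f g := by
  refine ⟨h.continuous.locallyIntegrable, h.locallyIntegrable, fun φ hφ hc => ?_⟩
  have hφ' : Continuous (deriv φ) := hφ.continuous_deriv (by simp)
  have hφP : IsPrimitive (fun x => (φ x : ℂ)) (fun x => ((deriv φ x : ℝ) : ℂ)) :=
    of_hasDerivAt (g := fun x => ((deriv φ x : ℝ) : ℂ))
      (fun x => (hφ.differentiable (by simp) x).hasDerivAt.ofReal_comp)
      (continuous_ofReal.comp hφ')
  have hInt₁ : Integrable fun x => deriv φ x • f x :=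
    (hφ'.smul h.continuous).integrable_of_hasCompactSupport hc.deriv.smul_right
  have hInt₂ : Integrable fun x => φ x • g x :=
    h.locallyIntegrable.integrable_smul_left_of_hasCompactSupport hφ.continuous hc
  have hsum : (fun x => φ x * g x + f x * deriv φ x) = fun x => deriv φ x • f x + φ x • g x := by
    ext x
    simp only [real_smul]
    ring
  have hsupp : HasCompactSupport fun x => (φ x : ℂ) * f x :=
    (hc.comp_left (g := ((↑) : ℝ → ℂ)) ofReal_zero).mul_right
  have h₀ := (hφP.mul h).integral_eq_zero
  rw [hsum] at h₀
  rw [eq_neg_iff_add_eq_zero, ← integral_add hInt₁ hInt₂]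
  exact h₀ (hInt₁.add hInt₂) hsupp

end IsPrimitive

namespace HasWeakDeriv

variable {f g F G : ℝ → ℂ}

theorem congr_ae (h : HasWeakDeriv f g) (hf : f =ᵐ[volume] F) (hg : g =ᵐ[volume] G) :
    HasWeakDeriv F G := by
  refine ⟨h.1.congr hf, h.2.1.congr hg, fun φ hφ hc => ?_⟩
  rw [integral_congr_ae (hf.symm.mono fun x hx => congrArg (deriv φ x • ·) hx),
    integral_congr_ae (hg.symm.mono fun x hx => congrArg (φ x • ·) hx), h.2.2 φ hφ hc]

theorem sub (h : HasWeakDeriv f g) (H : HasWeakDeriv F G) :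
    HasWeakDeriv (fun x => f x - F x) (fun x => g x - G x) := by
  refine ⟨h.1.sub H.1, h.2.1.sub H.2.1, fun φ hφ hc => ?_⟩
  have hφ' : Continuous (deriv φ) := hφ.continuous_deriv (by simp)
  simp only [smul_sub]
  rw [integral_sub (h.1.integrable_smul_left_of_hasCompactSupport hφ' hc.deriv)
      (H.1.integrable_smul_left_of_hasCompactSupport hφ' hc.deriv),
    integral_sub (h.2.1.integrable_smul_left_of_hasCompactSupport hφ.continuous hc)
      (H.2.1.integrable_smul_left_of_hasCompactSupport hφ.continuous hc),
    h.2.2 φ hφ hc, H.2.2 φ hφ hc]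
  ring

end HasWeakDeriv

theorem exists_contDiff_deriv_eq_of_integral_eq_zero {φ : ℝ → ℝ} (hφ : ContDiff ℝ ∞ φ)
    (hc : HasCompactSupport φ) (h₀ : ∫ x, φ x = 0) :
    ∃ Φ : ℝ → ℝ, ContDiff ℝ ∞ Φ ∧ HasCompactSupport Φ ∧ deriv Φ = φ := by
  have hInt : Integrable φ := hφ.continuous.integrable_of_hasCompactSupport hc
  have hd (x : ℝ) : HasDerivAt (fun x => ∫ t in Iic x, φ t) (φ x) x := by
    have hsplit : (fun x => ∫ t in Iic x, φ t) =
        fun x => (∫ t in Iic 0, φ t) + ∫ t in (0 : ℝ)..x, φ t := funext fun x => by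
      rw [← intervalIntegral.integral_Iic_sub_Iic hInt.integrableOn hInt.integrableOn]
      ring
    rw [hsplit]
    exact (hφ.continuous.integral_hasStrictDerivAt 0 x).hasDerivAt.const_add _
  have hderiv : deriv (fun x => ∫ t in Iic x, φ t) = φ := funext fun x => (hd x).deriv
  refine ⟨fun x => ∫ t in Iic x, φ t, ?_, ?_, hderiv⟩
  · rw [contDiff_infty_iff_deriv, hderiv]
    exact ⟨fun x => (hd x).differentiableAt, hφ⟩
  · rw [hasCompactSupport_iff_eventuallyEq, coclosedCompact_eq_cocompact,
      cocompact_eq_atBot_atTop, EventuallyEq, eventually_sup] at hc ⊢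
    refine ⟨?_, ?_⟩
    · filter_upwards [eventually_forall_le_atBot.2 hc.1] with x hx
      exact setIntegral_eq_zero_of_forall_eq_zero hx
    · filter_upwards [eventually_forall_ge_atTop.2 hc.2] with x hx
      have htail : ∫ t in Ioi x, φ t = 0 :=
        setIntegral_eq_zero_of_forall_eq_zero fun t ht => hx t (mem_Ioi.1 ht).le
      rw [← add_zero (∫ t in Iic x, φ t), ← htail,
        intervalIntegral.integral_Iic_add_Ioi hInt.integrableOn hInt.integrableOn, h₀,
        Pi.zero_apply]

namespace HasWeakDeriv

variable {f g : ℝ → ℂ}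

/- Testing `f` against `φ - (∫ φ) ρ`, where `∫ ρ = 1`, identifies `f` with the constant `∫ ρ f`. -/
theorem exists_ae_eq_const (h : HasWeakDeriv f fun _ => 0) : ∃ c : ℂ, ∀ᵐ x, f x = c := by
  let η : ContDiffBump (0 : ℝ) := ⟨1, 2, one_pos, one_lt_two⟩
  set ρ : ℝ → ℝ := η.normed volume
  have hρ : ContDiff ℝ ∞ ρ := η.contDiff_normed
  have hρc : HasCompactSupport ρ := η.hasCompactSupport_normed
  have hρ₁ : ∫ x, ρ x = 1 := η.integral_normed
  have hρf : Integrable fun x => ρ x • f x :=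
    h.1.integrable_smul_left_of_hasCompactSupport hρ.continuous hρc
  refine ⟨∫ x, ρ x • f x, ?_⟩
  refine ae_eq_of_integral_contDiff_smul_eq h.1 continuous_const.locallyIntegrable
    fun φ hφ hc => ?_
  have hφf : Integrable fun x => φ x • f x :=
    h.1.integrable_smul_left_of_hasCompactSupport hφ.continuous hc
  obtain ⟨Φ, hΦ, hΦc, hΦ'⟩ := exists_contDiff_deriv_eq_of_integral_eq_zero
    (hφ.sub (contDiff_const.mul hρ)) (hc.sub (hρc.mul_left (f := fun _ => ∫ y, φ y))) (by
      rw [integral_sub (hφ.continuous.integrable_of_hasCompactSupport hc)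
        ((hρ.continuous.integrable_of_hasCompactSupport hρc).const_mul _), integral_const_mul, hρ₁]
      ring)
  have htest := h.2.2 Φ hΦ hΦc
  simp only [smul_zero, integral_zero, neg_zero, hΦ', sub_smul, mul_smul] at htest
  rw [integral_sub hφf (hρf.fun_smul _), integral_smul, sub_eq_zero] at htest
  rw [htest, integral_smul_const]

theorem exists_isPrimitive (h : HasWeakDeriv f g) : ∃ F, f =ᵐ[volume] F ∧ IsPrimitive F g := by
  have hP : IsPrimitive (fun x => ∫ t in (0 : ℝ)..x, g t) g := ⟨h.2.1, fun x => by simp⟩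
  obtain ⟨c, hc⟩ := ((h.sub hP.hasWeakDeriv).congr_ae .rfl
    (G := fun _ => 0) (.of_forall fun x => sub_self _)).exists_ae_eq_const
  refine ⟨fun x => c + ∫ t in (0 : ℝ)..x, g t, ?_, h.2.1, fun x => by simp⟩
  filter_upwards [hc] with x hx
  rw [← hx, sub_add_cancel]

end HasWeakDeriv

/-! ### Integral operators on `L²` -/

section Schur

open scoped ENNReal NNReal

variable {α : Type*} [MeasurableSpace α] {μ : Measure α}

theorem lintegral_mul_rpow_two_le {f g : α → ℝ≥0∞} (hf : Measurable f) (hg : Measurable g) :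
    (∫⁻ y, f y * g y ∂μ) ^ (2 : ℝ) ≤ (∫⁻ y, f y ∂μ) * ∫⁻ y, f y * g y ^ (2 : ℝ) ∂μ := by
  have hroot (y : α) : (f y ^ (1 / 2 : ℝ)) ^ (2 : ℝ) = f y := by
    rw [← ENNReal.rpow_mul, one_div_mul_cancel two_ne_zero, ENNReal.rpow_one]
  have hholder := ENNReal.lintegral_mul_le_Lp_mul_Lq μ Real.HolderConjugate.two_two
    (f := fun y => f y ^ (1 / 2 : ℝ)) (g := fun y => f y ^ (1 / 2 : ℝ) * g y)
    (by fun_prop) (by fun_prop)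
  simp only [Pi.mul_apply, ← mul_assoc, ← sq, ← ENNReal.rpow_two, hroot,
    ENNReal.mul_rpow_of_nonneg _ _ zero_le_two] at hholder
  refine (ENNReal.rpow_le_rpow hholder zero_le_two).trans_eq ?_
  simp only [ENNReal.mul_rpow_of_nonneg _ _ zero_le_two, ← ENNReal.rpow_mul,
    one_div_mul_cancel (two_ne_zero (α := ℝ)), ENNReal.rpow_one]

/-- The hypothesis of the Schur test for an integral kernel: all rows and all columns have
`L¹`-norm at most `C`. -/
structure IsSchurKernel (μ : Measure α) (K : α → α → ℂ) (C : ℝ≥0) : Prop where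
  measurable : Measurable (Function.uncurry K)
  row : ∀ x, ∫⁻ y, ‖K x y‖ₑ ∂μ ≤ C
  col : ∀ y, ∫⁻ x, ‖K x y‖ₑ ∂μ ≤ C

theorem isSchurKernel_of_norm_le {K : α → α → ℂ} (hK : Measurable (Function.uncurry K))
    {A : Set α} (hA : μ A ≠ ⊤) {M : ℝ} (hM : ∀ x y, ‖K x y‖ ≤ M)
    (hsupp : ∀ x y, x ∉ A ∨ y ∉ A → K x y = 0) :
    IsSchurKernel μ K (M.toNNReal * (μ A).toNNReal) := by
  have hbound {k : α → ℂ} (hk : ∀ y, ‖k y‖ ≤ M) (hkA : ∀ y ∉ A, k y = 0) :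
      ∫⁻ y, ‖k y‖ₑ ∂μ ≤ (M.toNNReal * (μ A).toNNReal : ℝ≥0) := by
    rw [ENNReal.coe_mul, ENNReal.coe_toNNReal hA, ← setLIntegral_const,
      ← setLIntegral_eq_of_support_subset (s := A) fun y hy => by_contra fun h => by simp_all]
    exact lintegral_mono fun y => (ofReal_norm _).symm.le.trans (ENNReal.ofReal_le_ofReal (hk y))
  exact ⟨hK, fun x => hbound (hM x) fun y hy => hsupp x y (.inr hy),
    fun y => hbound (fun x => hM x y) fun x hx => hsupp x y (.inl hx)⟩

namespace IsSchurKernel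

variable {K L : α → α → ℂ} {C D E : ℝ≥0}

theorem sub (hK : IsSchurKernel μ K C) (hL : IsSchurKernel μ L D) :
    IsSchurKernel μ (fun x y => K x y - L x y) (C + D) where
  measurable := hK.measurable.sub hL.measurable
  row x := (lintegral_mono fun y => enorm_sub_le).trans <| by
    rw [lintegral_add_left hK.measurable.of_uncurry_left.enorm, ENNReal.coe_add]
    exact add_le_add (hK.row x) (hL.row x)
  col y := (lintegral_mono fun x => enorm_sub_le).trans <| by
    rw [lintegral_add_left hK.measurable.of_uncurry_right.enorm, ENNReal.coe_add]
    exact add_le_add (hK.col y) (hL.col y)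

theorem const_mul (c : ℂ) (hK : IsSchurKernel μ K C) :
    IsSchurKernel μ (fun x y => c * K x y) (‖c‖₊ * C) where
  measurable := hK.measurable.const_mul c
  row x := by
    simp only [enorm_mul, ENNReal.coe_mul, ← enorm_eq_nnnorm]
    rw [lintegral_const_mul _ hK.measurable.of_uncurry_left.enorm]
    gcongr
    exact hK.row x
  col y := by
    simp only [enorm_mul, ENNReal.coe_mul, ← enorm_eq_nnnorm]
    rw [lintegral_const_mul _ hK.measurable.of_uncurry_right.enorm]
    gcongr
    exact hK.col y

variable [SFinite μ]

theorem lintegral_sq_le (hK : IsSchurKernel μ K C) {v : α → ℂ} (hv : Measurable v) :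
    ∫⁻ x, (∫⁻ y, ‖K x y‖ₑ * ‖v y‖ₑ ∂μ) ^ (2 : ℝ) ∂μ ≤
      C * (C * ∫⁻ y, ‖v y‖ₑ ^ (2 : ℝ) ∂μ) := by
  have hm : Measurable fun p : α × α => ‖K p.1 p.2‖ₑ := hK.measurable.enorm
  calc ∫⁻ x, (∫⁻ y, ‖K x y‖ₑ * ‖v y‖ₑ ∂μ) ^ (2 : ℝ) ∂μ
      ≤ ∫⁻ x, C * ∫⁻ y, ‖K x y‖ₑ * ‖v y‖ₑ ^ (2 : ℝ) ∂μ ∂μ :=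
        lintegral_mono fun x => (lintegral_mul_rpow_two_le
          hK.measurable.of_uncurry_left.enorm hv.enorm).trans (mul_le_mul_left (hK.row x) _)
    _ = C * ∫⁻ y, ∫⁻ x, ‖K x y‖ₑ * ‖v y‖ₑ ^ (2 : ℝ) ∂μ ∂μ := by
        rw [lintegral_const_mul' _ _ ENNReal.coe_ne_top, lintegral_lintegral_swap
          (hm.mul ((hv.enorm.pow_const _).comp measurable_snd)).aemeasurable]
    _ = C * ∫⁻ y, (∫⁻ x, ‖K x y‖ₑ ∂μ) * ‖v y‖ₑ ^ (2 : ℝ) ∂μ := by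
        simp only [lintegral_mul_const _ hK.measurable.of_uncurry_right.enorm]
    _ ≤ C * ∫⁻ y, C * ‖v y‖ₑ ^ (2 : ℝ) ∂μ := by
        gcongr with y
        exact hK.col y
    _ = C * (C * ∫⁻ y, ‖v y‖ₑ ^ (2 : ℝ) ∂μ) := by
        rw [lintegral_const_mul' _ _ ENNReal.coe_ne_top]

theorem eLpNorm_le (hK : IsSchurKernel μ K C) {v : α → ℂ} (hv : Measurable v) :
    eLpNorm (fun x => ∫ y, K x y * v y ∂μ) 2 μ ≤ C * eLpNorm v 2 μ := by
  have hpointwise (x : α) : ‖∫ y, K x y * v y ∂μ‖ₑ ≤ ∫⁻ y, ‖K x y‖ₑ * ‖v y‖ₑ ∂μ :=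
    (enorm_integral_le_lintegral_enorm _).trans_eq (by simp only [enorm_mul])
  simp only [eLpNorm_eq_lintegral_rpow_enorm_toReal two_ne_zero ENNReal.ofNat_ne_top,
    ENNReal.toReal_ofNat]
  calc (∫⁻ x, ‖∫ y, K x y * v y ∂μ‖ₑ ^ (2 : ℝ) ∂μ) ^ (1 / 2 : ℝ)
      ≤ (C * (C * ∫⁻ y, ‖v y‖ₑ ^ (2 : ℝ) ∂μ)) ^ (1 / 2 : ℝ) := by
        gcongr
        exact (lintegral_mono fun x => ENNReal.rpow_le_rpow (hpointwise x) zero_le_two).trans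
          (hK.lintegral_sq_le hv)
    _ = C * (∫⁻ y, ‖v y‖ₑ ^ (2 : ℝ) ∂μ) ^ (1 / 2 : ℝ) := by
        rw [← mul_assoc, ← sq, ← ENNReal.rpow_two, ENNReal.mul_rpow_of_nonneg _ _ (by norm_num),
          ← ENNReal.rpow_mul, mul_one_div_cancel two_ne_zero, ENNReal.rpow_one]

theorem memLp (hK : IsSchurKernel μ K C) (v : Lp ℂ 2 μ) :
    MemLp (fun x => ∫ y, K x y * v y ∂μ) 2 μ := by
  have hv := (Lp.stronglyMeasurable v).measurable
  have hKv : Measurable fun p : α × α => K p.1 p.2 * v p.2 :=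
    hK.measurable.mul (hv.comp measurable_snd)
  exact ⟨hKv.stronglyMeasurable.integral_prod_right'.aestronglyMeasurable,
    (hK.eLpNorm_le hv).trans_lt (ENNReal.mul_lt_top ENNReal.coe_lt_top (Lp.eLpNorm_lt_top v))⟩

theorem ae_integrable (hK : IsSchurKernel μ K C) (v : Lp ℂ 2 μ) :
    ∀ᵐ x ∂μ, Integrable (fun y => K x y * v y) μ := by
  have hv := (Lp.stronglyMeasurable v).measurable
  have hm : Measurable fun p : α × α => ‖K p.1 p.2‖ₑ * ‖v p.2‖ₑ :=
    hK.measurable.enorm.mul (hv.enorm.comp measurable_snd)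
  have hfin : ∫⁻ x, (∫⁻ y, ‖K x y‖ₑ * ‖v y‖ₑ ∂μ) ^ (2 : ℝ) ∂μ ≠ ⊤ := by
    have hv₂ := lintegral_rpow_enorm_lt_top_of_eLpNorm_lt_top two_ne_zero ENNReal.ofNat_ne_top
      (Lp.eLpNorm_lt_top v)
    rw [ENNReal.toReal_ofNat] at hv₂
    exact ne_top_of_le_ne_top (ENNReal.mul_ne_top ENNReal.coe_ne_top
      (ENNReal.mul_ne_top ENNReal.coe_ne_top hv₂.ne)) (hK.lintegral_sq_le hv)
  filter_upwards [ae_lt_top (hm.lintegral_prod_right'.pow_const _) hfin] with x hx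
  refine ⟨(hK.measurable.of_uncurry_left.mul hv).aestronglyMeasurable, ?_⟩
  simp only [hasFiniteIntegral_iff_enorm, enorm_mul]
  exact (ENNReal.rpow_lt_top_iff_of_pos two_pos).1 hx

/-- The bounded operator on `L²` with integral kernel `K`. -/
def op (hK : IsSchurKernel μ K C) : Lp ℂ 2 μ →L[ℂ] Lp ℂ 2 μ :=
  LinearMap.mkContinuous
    { toFun := fun v => (hK.memLp v).toLp _
      map_add' := fun u v => by
        rw [← MemLp.toLp_add, MemLp.toLp_eq_toLp_iff]
        filter_upwards [hK.ae_integrable u, hK.ae_integrable v] with x hu hv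
        rw [Pi.add_apply, ← integral_add hu hv]
        refine integral_congr_ae ?_
        filter_upwards [Lp.coeFn_add u v] with y hy
        rw [hy, Pi.add_apply, mul_add]
      map_smul' := fun c v => by
        rw [RingHom.id_apply, ← MemLp.toLp_const_smul, MemLp.toLp_eq_toLp_iff]
        refine .of_forall fun x => ?_
        rw [Pi.smul_apply, ← integral_smul]
        refine integral_congr_ae ?_
        filter_upwards [Lp.coeFn_smul c v] with y hy
        rw [hy, Pi.smul_apply, mul_smul_comm] }
    C fun v => by
      rw [LinearMap.coe_mk, AddHom.coe_mk, Lp.norm_toLp, Lp.norm_def, ← ENNReal.coe_toReal,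
        ← ENNReal.toReal_mul]
      exact ENNReal.toReal_mono (ENNReal.mul_ne_top ENNReal.coe_ne_top (Lp.eLpNorm_ne_top v))
        (hK.eLpNorm_le (Lp.stronglyMeasurable v).measurable)

theorem coeFn_op (hK : IsSchurKernel μ K C) (v : Lp ℂ 2 μ) :
    hK.op v =ᵐ[μ] fun x => ∫ y, K x y * v y ∂μ :=
  (hK.memLp v).coeFn_toLp

theorem norm_op_le (hK : IsSchurKernel μ K C) : ‖hK.op‖ ≤ C :=
  LinearMap.mkContinuous_norm_le _ C.coe_nonneg _

theorem op_sub (hK : IsSchurKernel μ K C) (hL : IsSchurKernel μ L D)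
    (hKL : IsSchurKernel μ (fun x y => K x y - L x y) E) : hKL.op = hK.op - hL.op := by
  ext1 v
  refine Lp.ext ?_
  filter_upwards [hKL.coeFn_op v, hK.coeFn_op v, hL.coeFn_op v, hK.ae_integrable v,
    hL.ae_integrable v, Lp.coeFn_sub (hK.op v) (hL.op v)] with x hKLx hKx hLx hKi hLi hsub
  rw [_root_.sub_apply, hsub, Pi.sub_apply, hKLx, hKx, hLx, ← integral_sub hKi hLi]
  simp only [sub_mul]

theorem op_const_mul (c : ℂ) (hK : IsSchurKernel μ K C)
    (hcK : IsSchurKernel μ (fun x y => c * K x y) D) : hcK.op = c • hK.op := by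
  ext1 v
  refine Lp.ext ?_
  filter_upwards [hcK.coeFn_op v, hK.coeFn_op v, Lp.coeFn_smul c (hK.op v)] with x hcKx hKx hsmul
  rw [_root_.smul_apply, hsmul, Pi.smul_apply, hcKx, hKx, smul_eq_mul,
    ← integral_const_mul]
  simp only [mul_assoc]

end IsSchurKernel

theorem norm_sub_sub_mul_deriv_le {f : ℂ → ℂ} (hf : Differentiable ℂ f) {z₀ z : ℂ} {M : ℝ}
    (hM : ∀ z ∈ Metric.closedBall z₀ 1, ‖f z‖ ≤ M) (hz : z ∈ Metric.ball z₀ 1) :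
    ‖f z - f z₀ - (z - z₀) * deriv f z₀‖ ≤ 3 * M * ‖z - z₀‖ ^ 2 := by
  have hderiv : ‖deriv f z₀‖ ≤ M := by
    simpa using norm_deriv_le_of_forall_mem_sphere_norm_le one_pos hf.diffContOnCl
      fun w hw => hM w (Metric.sphere_subset_closedBall hw)
  have hmaps : MapsTo (fun w => f w - f z₀ - (w - z₀) * deriv f z₀) (Metric.ball z₀ 1)
      (Metric.closedBall (f z₀ - f z₀ - (z₀ - z₀) * deriv f z₀) (3 * M)) := fun w hw => by
    rw [mem_ball_iff_norm] at hw
    have hmul : ‖(w - z₀) * deriv f z₀‖ ≤ 1 * M := by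
      rw [norm_mul]
      gcongr
    rw [sub_self, sub_self, zero_mul, sub_zero, mem_closedBall_zero_iff]
    linarith [norm_sub_le (f w - f z₀) ((w - z₀) * deriv f z₀), norm_sub_le (f w) (f z₀),
      hM w (mem_closedBall_iff_norm.2 hw.le), hM z₀ (Metric.mem_closedBall_self zero_le_one)]
  have hlittle := hasDerivAt_iff_isLittleO.1 (hf z₀).hasDerivAt
  simpa [dist_eq_norm] using dist_le_mul_div_pow_of_mapsTo_ball_of_isLittleO (n := 1)
    (by fun_prop) hmaps (by simpa [← Asymptotics.isLittleO_norm_right] using hlittle) hz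

theorem measurable_deriv_of_differentiable {f : ℂ → α → ℂ} (hf : ∀ z, Measurable (f z))
    (hd : ∀ x, Differentiable ℂ fun z => f z x) (z₀ : ℂ) :
    Measurable fun x => deriv (fun z => f z x) z₀ := by
  have hseq : Tendsto (fun n : ℕ => z₀ + ((1 / (n + 1 : ℝ) : ℝ) : ℂ)) atTop (𝓝[≠] z₀) := by
    refine tendsto_nhdsWithin_iff.2 ⟨?_, .of_forall fun n => ?_⟩
    · simpa using tendsto_const_nhds.add
        ((continuous_ofReal.tendsto 0).comp tendsto_one_div_add_atTop_nhds_zero_nat)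
    · simpa using n.cast_add_one_ne_zero (R := ℂ)
  refine measurable_of_tendsto_metrizable (f := fun n : ℕ => fun x =>
    slope (fun z => f z x) z₀ (z₀ + ((1 / (n + 1 : ℝ) : ℝ) : ℂ))) (fun n => ?_)
    (tendsto_pi_nhds.2 fun x => (hd x z₀).hasDerivAt.tendsto_slope.comp hseq)
  simp only [slope_def_field]
  exact ((hf _).sub (hf _)).div_const _

theorem IsSchurKernel.exists_differentiable_op [SFinite μ] {K : ℂ → α → α → ℂ}
    (hK : ∀ z, Measurable (Function.uncurry (K z)))
    (hd : ∀ x y, Differentiable ℂ fun z => K z x y)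
    (hb : ∀ z₀, ∃ M : ℝ, ∀ z ∈ Metric.closedBall z₀ 1, ∀ x y, ‖K z x y‖ ≤ M)
    {A : Set α} (hA : μ A ≠ ⊤) (hsupp : ∀ z x y, x ∉ A ∨ y ∉ A → K z x y = 0) :
    ∃ B : ℂ → Lp ℂ 2 μ →L[ℂ] Lp ℂ 2 μ, Differentiable ℂ B ∧
      ∀ z v, B z v =ᵐ[μ] fun x => ∫ y, K z x y * v y ∂μ := by
  choose M hM using hb
  have hKz (z : ℂ) := isSchurKernel_of_norm_le (hK z) hA
    (hM z z (Metric.mem_closedBall_self zero_le_one)) (hsupp z)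
  refine ⟨fun z => (hKz z).op, fun z₀ => ?_, fun z => (hKz z).coeFn_op⟩
  have hK' : Measurable (Function.uncurry fun x y => deriv (fun z => K z x y) z₀) :=
    measurable_deriv_of_differentiable (f := fun z (p : α × α) => K z p.1 p.2) hK
      (fun p => hd p.1 p.2) z₀
  have hK's (x y : α) (hxy : x ∉ A ∨ y ∉ A) : deriv (fun z => K z x y) z₀ = 0 := by
    simp only [fun z => hsupp z x y hxy, deriv_const]
  have hderiv := isSchurKernel_of_norm_le hK' hA (M := M z₀) (fun x y => by
    simpa using norm_deriv_le_of_forall_mem_sphere_norm_le one_pos (hd x y).diffContOnCl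
      fun w hw => hM z₀ w (Metric.sphere_subset_closedBall hw) x y) hK's
  refine (hasDerivAt_iff_isLittleO.2 ?_ : HasDerivAt _ hderiv.op z₀).differentiableAt
  refine Asymptotics.IsBigO.trans_isLittleO (.of_bound (3 * |M z₀| * (μ A).toNNReal) ?_)
    (Asymptotics.isLittleO_pow_sub_sub z₀ one_lt_two)
  filter_upwards [Metric.ball_mem_nhds z₀ one_pos] with z hz
  have hdiff := (hKz z).sub (hKz z₀)
  have hmul := hderiv.const_mul (z - z₀)
  have hrem := isSchurKernel_of_norm_le (hdiff.measurable.sub hmul.measurable) hA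
    (fun x y => norm_sub_sub_mul_deriv_le (hd x y) (fun w hw => hM z₀ w hw x y) hz)
    (fun x y hxy => by simp [hsupp z x y hxy, hsupp z₀ x y hxy, hK's x y hxy])
  rw [← (hKz z).op_sub (hKz z₀) hdiff, ← hderiv.op_const_mul _ hmul, ← hdiff.op_sub hmul hrem]
  calc ‖hrem.op‖ ≤ (3 * M z₀ * ‖z - z₀‖ ^ 2).toNNReal * (μ A).toNNReal :=
        mod_cast hrem.norm_op_le
    _ ≤ 3 * |M z₀| * ‖z - z₀‖ ^ 2 * (μ A).toNNReal := by
        rw [Real.coe_toNNReal']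
        gcongr
        refine max_le ?_ (by positivity)
        gcongr
        exact le_abs_self _
    _ = 3 * |M z₀| * (μ A).toNNReal * ‖‖z - z₀‖ ^ 2‖ := by
        rw [norm_pow, norm_norm]
        ring

end Schur

/-! ### Solutions -/

/-- `ψ` with flux `p = a ψ'` solves the stationary equation `(a ψ')' = s² ψ`. -/
structure IsSolution (a : ℝ → ℝ) (s : ℂ) (ψ p : ℝ → ℂ) : Prop where
  isPrimitive : IsPrimitive ψ fun x => (a x : ℂ)⁻¹ * p x
  isPrimitive_flux : IsPrimitive p fun x => s ^ 2 * ψ x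

theorem exists_isSolution_of_hasWeakDeriv {a : ℝ → ℝ} (ha : ∀ x, a x ≠ 0) {s : ℂ}
    {ψ w : ℝ → ℂ} (hψ : HasWeakDeriv ψ w)
    (hw : HasWeakDeriv (fun x => (a x : ℂ) * w x) fun x => s ^ 2 * ψ x) :
    ∃ Ψ P, ψ =ᵐ[volume] Ψ ∧ (fun x => (a x : ℂ) * w x) =ᵐ[volume] P ∧ IsSolution a s Ψ P := by
  obtain ⟨Ψ, hψΨ, hΨ⟩ := hψ.exists_isPrimitive
  obtain ⟨P, hwP, hP⟩ := hw.exists_isPrimitive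
  refine ⟨Ψ, P, hψΨ, hwP, hΨ.congr_ae ?_, hP.congr_ae (hψΨ.mono fun x hx => ?_)⟩
  · filter_upwards [hwP] with x hx
    rw [← hx, inv_mul_cancel_left₀ (ofReal_ne_zero.2 (ha x))]
  · simp only [hx]

theorem memLp_restrict_of_continuousOn {f : ℝ → ℂ} {K : Set ℝ} (hK : IsCompact K)
    (hf : ContinuousOn f K) (p : ENNReal) : MemLp f p (volume.restrict K) := by
  obtain ⟨C, hC⟩ := hK.exists_bound_of_continuousOn hf
  have : IsFiniteMeasure (volume.restrict K) := isFiniteMeasure_restrict.2 hK.measure_ne_top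
  exact .of_bound (hf.aestronglyMeasurable hK.measurableSet) C
    (ae_restrict_of_forall_mem hK.measurableSet hC)

theorem memL2Loc_of_continuous {f : ℝ → ℂ} (hf : Continuous f) : MemL2Loc f :=
  fun _ hK => memLp_restrict_of_continuousOn hK hf.continuousOn 2

namespace IsSolution

variable {a a' : ℝ → ℝ} {s : ℂ} {ψ p θ q : ℝ → ℂ}

theorem continuous (h : IsSolution a s ψ p) : Continuous ψ := h.isPrimitive.continuous

theorem continuous_flux (h : IsSolution a s ψ p) : Continuous p := h.isPrimitive_flux.continuous

theorem congr_coeff (h : IsSolution a s ψ p) (ha : a =ᵐ[volume] a') : IsSolution a' s ψ p :=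
  ⟨h.isPrimitive.congr_ae (ha.mono fun x hx => by simp only [hx]), h.isPrimitive_flux⟩

theorem const_mul (c : ℂ) (h : IsSolution a s ψ p) :
    IsSolution a s (fun x => c * ψ x) fun x => c * p x := by
  constructor
  · simpa only [mul_left_comm] using h.isPrimitive.const_mul c
  · simpa only [mul_left_comm] using h.isPrimitive_flux.const_mul c

theorem comp_sub_left (h : IsSolution a s ψ p) (L : ℝ) :
    IsSolution (fun x => a (L - x)) s (fun x => ψ (L - x)) fun x => -p (L - x) := by
  constructor
  · simpa only [mul_neg] using h.isPrimitive.comp_sub_left L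
  · simpa only [neg_one_mul, neg_neg] using (h.isPrimitive_flux.comp_sub_left L).const_mul (-1)

theorem glue (h : IsSolution a s ψ p) (H : IsSolution a' s θ q) {c : ℝ} (hc : ψ c = θ c)
    (hc_flux : p c = q c) :
    IsSolution (fun x => if x < c then a x else a' x) s (fun x => if x < c then ψ x else θ x)
      fun x => if x < c then p x else q x := by
  constructor
  · convert h.isPrimitive.glue H.isPrimitive hc using 2 with x
    split_ifs <;> rfl
  · convert h.isPrimitive_flux.glue H.isPrimitive_flux hc_flux using 2 with x
    split_ifs <;> rfl

theorem wronskian_eq (h : IsSolution a s ψ p) (H : IsSolution a s θ q) (x y : ℝ) :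
    ψ x * q x - θ x * p x = ψ y * q y - θ y * p y := by
  refine IsPrimitive.eq_of_zero (f := fun x => ψ x * q x - θ x * p x) ?_ x y
  exact ((h.isPrimitive.mul H.isPrimitive_flux).sub (H.isPrimitive.mul h.isPrimitive_flux)).congr_ae
    (.of_forall fun t => by ring)

theorem exists_eq_linear_combination {θ₁ q₁ θ₂ q₂ : ℝ → ℂ} (h : IsSolution a s ψ p)
    (h₁ : IsSolution a s θ₁ q₁) (h₂ : IsSolution a s θ₂ q₂) {W : ℂ} (hW0 : W ≠ 0)
    (hW : ∀ x, θ₁ x * q₂ x - θ₂ x * q₁ x = W) :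
    ∃ α β : ℂ, ∀ x, ψ x = α * θ₁ x + β * θ₂ x := by
  refine ⟨(ψ 0 * q₂ 0 - θ₂ 0 * p 0) / W, (θ₁ 0 * p 0 - ψ 0 * q₁ 0) / W, fun x => ?_⟩
  rw [h.wronskian_eq h₂ 0 x, h₁.wronskian_eq h 0 x]
  field_simp
  rw [← hW x]
  ring

theorem hasH1LocDeriv_flux (h : IsSolution a s ψ p) : HasH1LocDeriv p fun x => s ^ 2 * ψ x :=
  ⟨memL2Loc_of_continuous h.continuous_flux,
    memL2Loc_of_continuous (continuous_const.mul h.continuous), h.isPrimitive_flux.hasWeakDeriv⟩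

theorem hasH1LocDeriv (h : IsSolution a s ψ p) (ha : Measurable a) {C : ℝ}
    (hC : ∀ x, |(a x)⁻¹| ≤ C) : HasH1LocDeriv ψ fun x => (a x : ℂ)⁻¹ * p x := by
  have hp := h.continuous_flux.measurable
  refine ⟨memL2Loc_of_continuous h.continuous, fun K hK => ?_, h.isPrimitive.hasWeakDeriv⟩
  refine (memL2Loc_of_continuous h.continuous_flux K hK).of_le_mul (c := C)
    (Measurable.aestronglyMeasurable (by fun_prop)) (.of_forall fun x => ?_)
  rw [norm_mul, ← ofReal_inv, norm_real, Real.norm_eq_abs]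
  gcongr
  exact hC x

end IsSolution

/-! ### Layered media -/

/-- The function equal to `f m` on the `m`-th layer `[x m, x (m + 1))` for `m ≤ n`; the layers
`m = 0` and `m = n` extend to infinity. -/
def layered {E : Type*} (x : ℕ → ℝ) (f : ℕ → ℝ → E) : ℕ → ℝ → E
  | 0, y => f 0 y
  | n + 1, y => if y < x (n + 1) then layered x f n y else f (n + 1) y

section Layered

variable {E : Type*} {x : ℕ → ℝ}

theorem layered_of_le {f : ℕ → ℝ → E} {n : ℕ} {y : ℝ} (hy : x n ≤ y) :
    layered x f n y = f n y := by
  cases n with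
  | zero => rfl
  | succ n => exact if_neg hy.not_gt

theorem layered_of_lt (hx : Monotone x) {f : ℕ → ℝ → E} {n : ℕ} {y : ℝ} (hy : y < x 1) :
    layered x f n y = f 0 y := by
  induction n with
  | zero => rfl
  | succ n ih => exact (if_pos (hy.trans_le (hx n.succ_pos))).trans ih

theorem continuous_layered [TopologicalSpace E] {Z : Type*} [TopologicalSpace Z]
    (hx : Monotone x) {f : ℕ → Z → ℝ → E} (hf : ∀ m, Continuous fun p : Z × ℝ => f m p.1 p.2)
    (hmatch : ∀ m z, f m z (x (m + 1)) = f (m + 1) z (x (m + 1))) (n : ℕ) :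
    Continuous fun p : Z × ℝ => layered x (fun m => f m p.1) n p.2 := by
  induction n with
  | zero => exact hf 0
  | succ n ih =>
    have hflip : (fun p : Z × ℝ => layered x (fun m => f m p.1) (n + 1) p.2) =
        fun p => if x (n + 1) ≤ p.2 then f (n + 1) p.1 p.2
          else layered x (fun m => f m p.1) n p.2 :=
      funext fun p => by simp only [layered, ← not_le, ite_not]
    rw [hflip]
    refine (hf _).if_le ih continuous_const continuous_snd fun p hp => ?_
    rw [← hp, layered_of_le (hx n.le_succ), hmatch]

theorem differentiable_layered {f : ℕ → ℂ → ℝ → ℂ}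
    (hf : ∀ m y, Differentiable ℂ fun s => f m s y) (n : ℕ) (y : ℝ) :
    Differentiable ℂ fun s => layered x (fun m => f m s) n y := by
  induction n with
  | zero => exact hf 0 y
  | succ n ih =>
    by_cases hy : y < x (n + 1)
    · simpa only [layered, if_pos hy] using ih
    · simpa only [layered, if_neg hy] using hf (n + 1) y

theorem isSolution_layered (hx : Monotone x) {a : ℕ → ℝ → ℝ} {s : ℂ} {ψ p : ℕ → ℝ → ℂ}
    (h : ∀ m, IsSolution (a m) s (ψ m) (p m))
    (hψ : ∀ m, ψ m (x (m + 1)) = ψ (m + 1) (x (m + 1)))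
    (hp : ∀ m, p m (x (m + 1)) = p (m + 1) (x (m + 1))) (n : ℕ) :
    IsSolution (layered x a n) s (layered x ψ n) (layered x p n) := by
  induction n with
  | zero => exact h 0
  | succ n ih =>
    refine ih.glue (h (n + 1)) ?_ ?_
    · rw [layered_of_le (hx n.le_succ), hψ]
    · rw [layered_of_le (hx n.le_succ), hp]

end Layered

/-- The pair `(det D_{n+1}, det D̃_{n+1})` attached to the `n`-th layer, extended to the leftmost
layer `n = 0` by the value `(-1, 0)` that is consistent with the recursion. -/
def layerPair (b x : ℕ → ℝ) (s : ℂ) : ℕ → ℂ × ℂ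
  | 0 => (-1, 0)
  | n + 1 => detPair b x s (n + 2)

section Layers

variable (b x : ℕ → ℝ) (s : ℂ)

/-- The left-moving exponential in layer `n`, with amplitude `det D_{n+1}`. -/
def leftWave (n : ℕ) (y : ℝ) : ℂ := (layerPair b x s n).1 * exp (s * b (n + 1) * y)

/-- The right-moving exponential in layer `n`, with amplitude `det D̃_{n+1}`. -/
def rightWave (n : ℕ) (y : ℝ) : ℂ := (layerPair b x s n).2 * exp (-s * b (n + 1) * y)

/-- The normalization that makes the layer solutions match at the interfaces. -/
def layerNorm : ℕ → ℝ
  | 0 => -1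
  | m + 1 => -layerNorm m / (2 * b (m + 1))

/-- The left-outgoing solution in layer `n`. -/
def layerSol (n : ℕ) (y : ℝ) : ℂ := layerNorm b n * (leftWave b x s n y - rightWave b x s n y)

/-- The flux of the left-outgoing solution in layer `n`. -/
def layerFlux (n : ℕ) (y : ℝ) : ℂ :=
  layerNorm b n * (s / b (n + 1)) * (leftWave b x s n y + rightWave b x s n y)

/-- The step function with values `b_j⁻²` in the first `n + 1` layers. -/
def stepCoeff : ℕ → ℝ → ℝ := layered x fun m _ => (b (m + 1) ^ 2)⁻¹

/-- The left-outgoing (Jost) solution for `stepCoeff b x n`. -/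
def jost : ℕ → ℝ → ℂ := layered x (layerSol b x s)

/-- The flux of the left-outgoing solution for `stepCoeff b x n`. -/
def jostFlux : ℕ → ℝ → ℂ := layered x (layerFlux b x s)

theorem waves_matching (n : ℕ) :
    leftWave b x s (n + 1) (x (n + 1)) =
        (b (n + 1) - b (n + 2)) * rightWave b x s n (x (n + 1)) -
          (b (n + 1) + b (n + 2)) * leftWave b x s n (x (n + 1)) ∧
      rightWave b x s (n + 1) (x (n + 1)) =
        (b (n + 1) - b (n + 2)) * leftWave b x s n (x (n + 1)) -
          (b (n + 1) + b (n + 2)) * rightWave b x s n (x (n + 1)) := by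
  have hexp (c : ℂ) : exp (-s * c * x (n + 1)) = (exp (s * c * x (n + 1)))⁻¹ := by
    rw [← exp_neg, neg_mul, neg_mul]
  cases n with
  | zero =>
    have hleft : -s * x 1 * (b 2 - b 1) = s * b 1 * x 1 - s * b 2 * x 1 := by ring
    have hright : s * x 1 * (b 1 + b 2) = s * b 1 * x 1 + s * b 2 * x 1 := by ring
    simp only [leftWave, rightWave, layerPair, detPair, hleft, hright, hexp, exp_sub, exp_add]
    constructor <;> field_simp <;> ring
  | succ n =>
    simp only [leftWave, rightWave, layerPair, detPair, hexp]
    constructor <;> field_simp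

variable {b}

theorem layer_matching (hb : ∀ n, 0 < b n) (n : ℕ) :
    layerSol b x s n (x (n + 1)) = layerSol b x s (n + 1) (x (n + 1)) ∧
      layerFlux b x s n (x (n + 1)) = layerFlux b x s (n + 1) (x (n + 1)) := by
  have hb₁ : (b (n + 1) : ℂ) ≠ 0 := ofReal_ne_zero.2 (hb _).ne'
  have hb₂ : (b (n + 2) : ℂ) ≠ 0 := ofReal_ne_zero.2 (hb _).ne'
  obtain ⟨hleft, hright⟩ := waves_matching b x s n
  constructor <;>
  · simp only [layerSol, layerFlux, hleft, hright, layerNorm]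
    push_cast
    field_simp
    ring

theorem layerNorm_ne_zero (hb : ∀ n, 0 < b n) (n : ℕ) : layerNorm b n ≠ 0 := by
  induction n with
  | zero => exact neg_ne_zero.2 one_ne_zero
  | succ n ih => exact div_ne_zero (neg_ne_zero.2 ih) (mul_pos two_pos (hb _)).ne'

theorem hasDerivAt_exp_mul (c : ℂ) (y : ℝ) :
    HasDerivAt (fun y : ℝ => exp (c * y)) (c * exp (c * y)) y := by
  simpa [mul_comm] using ((hasDerivAt_id y).ofReal_comp.const_mul c).cexp

theorem isSolution_layer (hb : ∀ n, 0 < b n) (n : ℕ) :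
    IsSolution (fun _ => (b (n + 1) ^ 2)⁻¹) s (layerSol b x s n) (layerFlux b x s n) := by
  have hbn : (b (n + 1) : ℂ) ≠ 0 := ofReal_ne_zero.2 (hb _).ne'
  have hleft (y : ℝ) : HasDerivAt (leftWave b x s n) (s * b (n + 1) * leftWave b x s n y) y :=
    ((hasDerivAt_exp_mul _ y).const_mul _).congr_deriv (mul_left_comm _ _ _)
  have hright (y : ℝ) : HasDerivAt (rightWave b x s n) (-s * b (n + 1) * rightWave b x s n y) y :=
    ((hasDerivAt_exp_mul _ y).const_mul _).congr_deriv (mul_left_comm _ _ _)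
  have hl : Continuous (leftWave b x s n) := by unfold leftWave; fun_prop
  have hr : Continuous (rightWave b x s n) := by unfold rightWave; fun_prop
  constructor
  · refine .of_hasDerivAt (fun y => (((hleft y).sub (hright y)).const_mul _).congr_deriv ?_)
      (by unfold layerFlux; fun_prop)
    simp only [layerFlux]
    push_cast
    field_simp
    ring
  · refine .of_hasDerivAt (fun y => (((hleft y).add (hright y)).const_mul _).congr_deriv ?_)
      (by unfold layerSol; fun_prop)
    simp only [layerSol]
    field_simp
    ring

variable {x}

theorem isSolution_jost (hb : ∀ n, 0 < b n) (hx : Monotone x) (n : ℕ) :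
    IsSolution (stepCoeff b x n) s (jost b x s n) (jostFlux b x s n) :=
  isSolution_layered hx (isSolution_layer x s hb) (fun m => (layer_matching x s hb m).1)
    (fun m => (layer_matching x s hb m).2) n

theorem differentiable_layerPair (n : ℕ) :
    Differentiable ℂ (fun s => (layerPair b x s n).1) ∧
      Differentiable ℂ fun s => (layerPair b x s n).2 := by
  cases n with
  | zero => simp only [layerPair, differentiable_const, and_self]
  | succ n =>
    induction n with
    | zero => simp only [layerPair, detPair]; constructor <;> fun_prop
    | succ n ih =>
      obtain ⟨hD, hD'⟩ := ih
      simp only [layerPair, detPair] at hD hD' ⊢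
      constructor <;> fun_prop

theorem differentiable_jost (n : ℕ) (y : ℝ) : Differentiable ℂ fun s => jost b x s n y :=
  differentiable_layered (fun m y => by
    obtain ⟨hD, hD'⟩ := differentiable_layerPair (b := b) (x := x) m
    unfold layerSol leftWave rightWave
    fun_prop) n y

theorem continuous_uncurry_jost (hb : ∀ n, 0 < b n) (hx : Monotone x) (n : ℕ) :
    Continuous fun p : ℂ × ℝ => jost b x p.1 n p.2 :=
  continuous_layered hx (fun m => by
    obtain ⟨hD, hD'⟩ := differentiable_layerPair (b := b) (x := x) m
    have hD := hD.continuous.comp (continuous_fst (Y := ℝ))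
    have hD' := hD'.continuous.comp (continuous_fst (Y := ℝ))
    simp only [Function.comp_def] at hD hD'
    unfold layerSol leftWave rightWave
    fun_prop) (fun m s => (layer_matching x s hb m).1) n

theorem normSq_sub_normSq_of_interface (β β' : ℝ) (p q : ℂ) :
    normSq ((β - β') * q - (β + β') * p) - normSq ((β - β') * p - (β + β') * q) =
      4 * β * β' * (normSq p - normSq q) := by
  simp only [normSq_apply, sub_re, sub_im, mul_re, mul_im, add_re, add_im, ofReal_re, ofReal_im]
  ring

theorem norm_rightWave_lt_norm_leftWave (hb : ∀ n, 0 < b n) (hx : Monotone x) (hs : 0 ≤ s.re)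
    (n : ℕ) {y : ℝ} (hy : x n ≤ y) : ‖rightWave b x s n y‖ < ‖leftWave b x s n y‖ := by
  induction n generalizing y with
  | zero => simp [leftWave, rightWave, layerPair]
  | succ n ih =>
    have hinterface : ‖rightWave b x s (n + 1) (x (n + 1))‖ <
        ‖leftWave b x s (n + 1) (x (n + 1))‖ := by
      obtain ⟨hleft, hright⟩ := waves_matching b x s n
      have hn := pow_lt_pow_left₀ (ih (hx n.le_succ)) (norm_nonneg _) two_ne_zero
      have hpos := mul_pos (mul_pos four_pos (hb (n + 1))) (hb (n + 2))
      refine lt_of_pow_lt_pow_left₀ 2 (norm_nonneg _) ?_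
      simp only [← normSq_eq_norm_sq, hleft, hright] at hn ⊢
      rw [← sub_pos, normSq_sub_normSq_of_interface]
      exact mul_pos hpos (sub_pos.2 hn)
    have hexp : s.re * b (n + 2) * x (n + 1) ≤ s.re * b (n + 2) * y :=
      mul_le_mul_of_nonneg_left hy (mul_nonneg hs (hb _).le)
    simp only [leftWave, rightWave, norm_mul, norm_exp, mul_re, neg_re, ofReal_re,
      ofReal_im, mul_im, mul_zero, sub_zero, neg_mul] at hinterface ⊢
    refine lt_of_le_of_lt ?_ (hinterface.trans_le ?_) <;> gcongr

theorem layerPair_fst_ne_zero (hb : ∀ n, 0 < b n) (hx : Monotone x) (hs : 0 ≤ s.re) (n : ℕ) :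
    (layerPair b x s n).1 ≠ 0 := fun hD => by
  have h := norm_rightWave_lt_norm_leftWave s hb hx hs n le_rfl
  rw [leftWave, hD, zero_mul, norm_zero] at h
  exact h.not_ge (norm_nonneg _)

theorem layerPair_ne_zero (hb : ∀ n, 0 < b n) (n : ℕ) : layerPair b x s n ≠ 0 := by
  induction n with
  | zero => simp [layerPair]
  | succ n ih =>
    refine fun h => ih ?_
    obtain ⟨hleft, hright⟩ := waves_matching b x s n
    have hβ : (4 * b (n + 1) * b (n + 2) : ℂ) ≠ 0 := by
      exact_mod_cast (mul_pos (mul_pos four_pos (hb (n + 1))) (hb (n + 2))).ne'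
    rw [leftWave, h, Prod.fst_zero, zero_mul] at hleft
    rw [rightWave, h, Prod.snd_zero, zero_mul] at hright
    have hl : leftWave b x s n (x (n + 1)) = 0 := (mul_eq_zero.1 (by
      linear_combination (b (n + 1) + b (n + 2) : ℂ) * hleft +
        (b (n + 1) - b (n + 2) : ℂ) * hright)).resolve_left hβ
    have hr : rightWave b x s n (x (n + 1)) = 0 := (mul_eq_zero.1 (by
      linear_combination (b (n + 1) - b (n + 2) : ℂ) * hleft +
        (b (n + 1) + b (n + 2) : ℂ) * hright)).resolve_left hβ
    exact Prod.ext ((mul_eq_zero.1 hl).resolve_right (exp_ne_zero _))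
      ((mul_eq_zero.1 hr).resolve_right (exp_ne_zero _))

end Layers

/-! ### Green kernels -/

theorem integrable_exp_neg_mul_abs {κ : ℝ} (hκ : 0 < κ) :
    Integrable fun t : ℝ => Real.exp (-κ * |t|) := by
  rw [← integrableOn_univ, ← Iic_union_Ioi (a := (0 : ℝ))]
  refine IntegrableOn.union ?_ ?_
  · refine (integrableOn_exp_mul_Iic hκ 0).congr_fun (fun t ht => ?_) measurableSet_Iic
    simp only [abs_of_nonpos (mem_Iic.1 ht), neg_mul_neg]
  · refine (integrableOn_exp_mul_Ioi (neg_lt_zero.2 hκ) 0).congr_fun (fun t ht => ?_)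
      measurableSet_Ioi
    simp only [abs_of_pos (mem_Ioi.1 ht)]

theorem isSchurKernel_of_norm_le_comp_sub {K : ℝ → ℝ → ℂ}
    (hK : Measurable (Function.uncurry K)) {h : ℝ → ℝ} (hh : Integrable h)
    (hle : ∀ x y, ‖K x y‖ ≤ h (x - y)) :
    IsSchurKernel volume K (∫⁻ t, ENNReal.ofReal (h t)).toNNReal := by
  have hle' (x y : ℝ) : ‖K x y‖ₑ ≤ ENNReal.ofReal (h (x - y)) :=
    (ofReal_norm _).symm.le.trans (ENNReal.ofReal_le_ofReal (hle x y))
  refine ⟨hK, fun x => ?_, fun y => ?_⟩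
  all_goals rw [ENNReal.coe_toNNReal hh.lintegral_lt_top.ne]
  · exact (lintegral_mono (hle' x)).trans
      (lintegral_sub_left_eq_self (fun t => ENNReal.ofReal (h t)) x).le
  · exact (lintegral_mono (hle' · y)).trans
      (lintegral_sub_right_eq_self (fun t => ENNReal.ofReal (h t)) y).le

theorem exists_norm_mul_le_exp_neg_mul_abs {κ : ℝ} {f g : ℝ → ℂ}
    (hf : f =O[⊤] fun x => Real.exp (-κ * x)) (hg : g =O[⊤] fun x => Real.exp (κ * x)) :
    ∃ C : ℝ, ∀ x y, y ≤ x → ‖f x * g y‖ ≤ C * Real.exp (-κ * |x - y|) := by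
  obtain ⟨A, hA, hfA⟩ := hf.exists_nonneg
  obtain ⟨B, -, hgB⟩ := hg.exists_nonneg
  rw [Asymptotics.isBigOWith_top] at hfA hgB
  refine ⟨A * B, fun x y hyx => ?_⟩
  calc ‖f x * g y‖ ≤ A * Real.exp (-κ * x) * (B * Real.exp (κ * y)) := by
        rw [norm_mul]
        gcongr
        · simpa using hfA x
        · simpa using hgB y
    _ = A * B * Real.exp (-κ * |x - y|) := by
        rw [mul_mul_mul_comm, ← Real.exp_add, abs_of_nonneg (sub_nonneg.2 hyx)]
        ring_nf

/-- The kernel `f₁ x * g₁ y` for `y ≤ x` and `f₂ x * g₂ y` for `x < y`. For solutions of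
`(a ψ')' = s² ψ`, decaying at `∞` for `f₁ = g₂` and at `-∞` for `f₂ = g₁`, it is a multiple of the
integral kernel of `(-∂ₓ a ∂ₓ + s²)⁻¹`. -/
def greenKernel (f₁ g₁ f₂ g₂ : ℝ → ℂ) (x y : ℝ) : ℂ :=
  if y ≤ x then f₁ x * g₁ y else f₂ x * g₂ y

section GreenKernel

variable {f₁ g₁ f₂ g₂ : ℝ → ℂ}

theorem measurable_greenKernel (hf₁ : Measurable f₁) (hg₁ : Measurable g₁)
    (hf₂ : Measurable f₂) (hg₂ : Measurable g₂) :
    Measurable (Function.uncurry (greenKernel f₁ g₁ f₂ g₂)) :=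
  Measurable.ite (measurableSet_le measurable_snd measurable_fst)
    ((hf₁.comp measurable_fst).mul (hg₁.comp measurable_snd))
    ((hf₂.comp measurable_fst).mul (hg₂.comp measurable_snd))

theorem exists_isSchurKernel_greenKernel {κ : ℝ} (hκ : 0 < κ)
    (hf₁ : Continuous f₁) (hg₁ : Continuous g₁) (hf₂ : Continuous f₂) (hg₂ : Continuous g₂)
    (bf₁ : f₁ =O[⊤] fun x => Real.exp (-κ * x)) (bg₁ : g₁ =O[⊤] fun x => Real.exp (κ * x))
    (bf₂ : f₂ =O[⊤] fun x => Real.exp (κ * x)) (bg₂ : g₂ =O[⊤] fun x => Real.exp (-κ * x)) :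
    ∃ C, IsSchurKernel volume (greenKernel f₁ g₁ f₂ g₂) C := by
  obtain ⟨C₁, hC₁⟩ := exists_norm_mul_le_exp_neg_mul_abs bf₁ bg₁
  obtain ⟨C₂, hC₂⟩ := exists_norm_mul_le_exp_neg_mul_abs bg₂ bf₂
  refine ⟨_, isSchurKernel_of_norm_le_comp_sub (measurable_greenKernel hf₁.measurable
    hg₁.measurable hf₂.measurable hg₂.measurable)
    ((integrable_exp_neg_mul_abs hκ).const_mul (max C₁ C₂)) fun x y => ?_⟩
  rcases le_or_gt y x with hyx | hxy
  · rw [greenKernel, if_pos hyx]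
    refine (hC₁ x y hyx).trans ?_
    gcongr
    exact le_max_left _ _
  · rw [greenKernel, if_neg hxy.not_ge, mul_comm]
    refine (hC₂ y x hxy.le).trans ?_
    rw [abs_sub_comm]
    gcongr
    exact le_max_right _ _

theorem integral_greenKernel_mul {v : ℝ → ℂ} {x : ℝ}
    (h₁ : IntegrableOn (fun y => g₁ y * v y) (Iic x))
    (h₂ : IntegrableOn (fun y => g₂ y * v y) (Ioi x)) :
    ∫ y, greenKernel f₁ g₁ f₂ g₂ x y * v y =
      f₁ x * (∫ y in Iic x, g₁ y * v y) + f₂ x * ∫ y in Ioi x, g₂ y * v y := by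
  have e₁ : EqOn (fun y => f₁ x * (g₁ y * v y)) (fun y => greenKernel f₁ g₁ f₂ g₂ x y * v y)
      (Iic x) := fun y hy => by simp only [greenKernel, if_pos (mem_Iic.1 hy), mul_assoc]
  have e₂ : EqOn (fun y => f₂ x * (g₂ y * v y)) (fun y => greenKernel f₁ g₁ f₂ g₂ x y * v y)
      (Ioi x) := fun y hy => by simp only [greenKernel, if_neg (mem_Ioi.1 hy).not_ge, mul_assoc]
  have i₁ := IntegrableOn.congr_fun (h₁.const_mul (f₁ x)) e₁ measurableSet_Iic
  have i₂ := IntegrableOn.congr_fun (h₂.const_mul (f₂ x)) e₂ measurableSet_Ioi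
  rw [← intervalIntegral.integral_Iic_add_Ioi i₁ i₂, ← setIntegral_congr_fun measurableSet_Iic e₁,
    ← setIntegral_congr_fun measurableSet_Ioi e₂, integral_const_mul, integral_const_mul]

theorem isPrimitive_integral_Iic {g : ℝ → ℂ} (hg : ∀ x, IntegrableOn g (Iic x)) :
    IsPrimitive (fun x => ∫ y in Iic x, g y) g :=
  .of_sub_eq (fun x => ⟨Iic (x + 1), Iic_mem_nhds (lt_add_one x), hg _⟩) 0
    fun x => intervalIntegral.integral_Iic_sub_Iic (hg 0) (hg x)

theorem isPrimitive_integral_Ioi {g : ℝ → ℂ} (hg : ∀ x, IntegrableOn g (Ioi x)) :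
    IsPrimitive (fun x => ∫ y in Ioi x, g y) fun x => -g x :=
  .of_sub_eq (LocallyIntegrable.neg fun x => ⟨Ioi (x - 1), Ioi_mem_nhds (sub_one_lt x), hg _⟩) 0
    fun x => by
      rw [intervalIntegral.integral_neg,
        ← intervalIntegral.integral_Ioi_sub_Ioi' (hg 0) (hg x), neg_sub]

theorem isPrimitive_greenKernel {c p₁ p₂ v : ℝ → ℂ} (hf₁ : IsPrimitive f₁ fun x => c x * p₁ x)
    (hf₂ : IsPrimitive f₂ fun x => c x * p₂ x)
    (h₁ : ∀ x, IntegrableOn (fun y => g₁ y * v y) (Iic x))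
    (h₂ : ∀ x, IntegrableOn (fun y => g₂ y * v y) (Ioi x)) :
    IsPrimitive (fun x => ∫ y, greenKernel f₁ g₁ f₂ g₂ x y * v y)
      (fun x => c x * (∫ y, greenKernel p₁ g₁ p₂ g₂ x y * v y) +
        (f₁ x * g₁ x - f₂ x * g₂ x) * v x) := by
  simp only [fun f₁ f₂ x => integral_greenKernel_mul (f₁ := f₁) (f₂ := f₂) (h₁ x) (h₂ x)]
  refine ((hf₁.mul (isPrimitive_integral_Iic h₁)).add
    (hf₂.mul (isPrimitive_integral_Ioi h₂))).congr_ae (.of_forall fun x => ?_)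
  ring

end GreenKernel

theorem memLp_two_of_isBigO_exp {c : ℝ} {A : Set ℝ}
    (hA : IntegrableOn (fun y => Real.exp (2 * c * y)) A) {g : ℝ → ℂ} (hg : Continuous g)
    (h : g =O[⊤] fun x => Real.exp (c * x)) : MemLp g 2 (volume.restrict A) := by
  obtain ⟨C, hC⟩ := h.bound
  rw [eventually_top] at hC
  have hexp : MemLp (fun y => Real.exp (c * y)) 2 (volume.restrict A) := by
    rw [memLp_two_iff_integrable_sq (by fun_prop)]
    refine hA.congr (.of_forall fun y => ?_)
    simp only [← Real.exp_nat_mul, Nat.cast_ofNat, mul_assoc]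
  exact hexp.of_le_mul hg.aestronglyMeasurable (.of_forall hC)

theorem memLp_Iic_of_isBigO_exp {κ : ℝ} (hκ : 0 < κ) {g : ℝ → ℂ} (hg : Continuous g)
    (h : g =O[⊤] fun x => Real.exp (κ * x)) (x : ℝ) : MemLp g 2 (volume.restrict (Iic x)) :=
  memLp_two_of_isBigO_exp (integrableOn_exp_mul_Iic (mul_pos two_pos hκ) x) hg h

theorem memLp_Ioi_of_isBigO_exp {κ : ℝ} (hκ : 0 < κ) {g : ℝ → ℂ} (hg : Continuous g)
    (h : g =O[⊤] fun x => Real.exp (-κ * x)) (x : ℝ) : MemLp g 2 (volume.restrict (Ioi x)) :=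
  memLp_two_of_isBigO_exp
    (integrableOn_exp_mul_Ioi (mul_neg_of_pos_of_neg two_pos (neg_lt_zero.2 hκ)) x) hg h

/-! ### Resolvents of divergence form operators -/

/-- `a` is a measurable coefficient with `m ≤ a ≤ M`, where `m > 0`. -/
structure IsUniformlyElliptic (a : ℝ → ℝ) (m M : ℝ) : Prop where
  measurable : Measurable a
  pos : 0 < m
  le : ∀ x, m ≤ a x
  ge : ∀ x, a x ≤ M

/-- The graph of the operator `u ↦ -(a u')'` in `L²(ℝ)`, whose domain consists of the `u ∈ H¹(ℝ)`
with `a u' ∈ H¹(ℝ)`. -/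
def DivGraph (a : ℝ → ℝ) (u f : L2) : Prop :=
  ∃ w : L2, HasWeakDeriv u w ∧ HasWeakDeriv (fun x => (a x : ℂ) * w x) fun x => -f x

theorem DivGraph.sub {a : ℝ → ℝ} {u f u' f' : L2} (h : DivGraph a u f) (h' : DivGraph a u' f') :
    DivGraph a (u - u') (f - f') := by
  obtain ⟨w, hu, hw⟩ := h
  obtain ⟨w', hu', hw'⟩ := h'
  refine ⟨w - w', (hu.sub hu').congr_ae (Lp.coeFn_sub u u').symm (Lp.coeFn_sub w w').symm,
    (hw.sub hw').congr_ae ?_ ?_⟩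
  · filter_upwards [Lp.coeFn_sub w w'] with x hx
    rw [hx, Pi.sub_apply, mul_sub]
  · filter_upwards [Lp.coeFn_sub f f'] with x hx
    rw [hx, Pi.sub_apply]
    ring

namespace IsUniformlyElliptic

variable {a : ℝ → ℝ} {m M : ℝ}

theorem ne_zero (ha : IsUniformlyElliptic a m M) (x : ℝ) : a x ≠ 0 :=
  (ha.pos.trans_le (ha.le x)).ne'

theorem abs_inv_le (ha : IsUniformlyElliptic a m M) (x : ℝ) : |(a x)⁻¹| ≤ m⁻¹ := by
  rw [abs_inv, abs_of_pos (ha.pos.trans_le (ha.le x))]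
  exact inv_anti₀ ha.pos (ha.le x)

theorem memLp_mul (ha : IsUniformlyElliptic a m M) {f : ℝ → ℂ} (hf : MemLp f 2) :
    MemLp (fun x => (a x : ℂ) * f x) 2 := by
  refine hf.of_le_mul (c := M) ((measurable_ofReal.comp ha.measurable).aestronglyMeasurable.mul
    hf.1) (.of_forall fun x => ?_)
  rw [norm_mul, norm_real, Real.norm_of_nonneg (ha.pos.le.trans (ha.le x))]
  gcongr
  exact ha.ge x

theorem memLp_inv_mul (ha : IsUniformlyElliptic a m M) {f : ℝ → ℂ} (hf : MemLp f 2) :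
    MemLp (fun x => (a x : ℂ)⁻¹ * f x) 2 := by
  refine hf.of_le_mul (c := m⁻¹) ((measurable_ofReal.comp
    ha.measurable).inv.aestronglyMeasurable.mul hf.1) (.of_forall fun x => ?_)
  rw [norm_mul, ← ofReal_inv, norm_real]
  gcongr
  exact ha.abs_inv_le x

theorem divGraph_of_isPrimitive (ha : IsUniformlyElliptic a m M) {ψ p g : ℝ → ℂ}
    (hψ : IsPrimitive ψ fun x => (a x : ℂ)⁻¹ * p x) (hp : IsPrimitive p g) (hp₂ : MemLp p 2)
    {u f : L2} (hu : u =ᵐ[volume] ψ) (hf : ∀ᵐ x, g x = -f x) : DivGraph a u f := by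
  have hw := ha.memLp_inv_mul hp₂
  refine ⟨hw.toLp _, hψ.hasWeakDeriv.congr_ae hu.symm hw.coeFn_toLp.symm,
    hp.hasWeakDeriv.congr_ae ?_ hf⟩
  filter_upwards [hw.coeFn_toLp] with x hx
  rw [hx, mul_inv_cancel_left₀ (ofReal_ne_zero.2 (ha.ne_zero x))]

end IsUniformlyElliptic

/-- Two solutions of `(a ψ')' = s² ψ` whose values and fluxes are `O(e^{κ x})` for `θL` and
`O(e^{-κ x})` for `θR`. -/
structure IsDecayingPair (a : ℝ → ℝ) (s : ℂ) (κ : ℝ) (θL pL θR pR : ℝ → ℂ) : Prop where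
  left : IsSolution a s θL pL
  right : IsSolution a s θR pR
  isBigO_left : θL =O[⊤] fun x => Real.exp (κ * x)
  isBigO_left_flux : pL =O[⊤] fun x => Real.exp (κ * x)
  isBigO_right : θR =O[⊤] fun x => Real.exp (-κ * x)
  isBigO_right_flux : pR =O[⊤] fun x => Real.exp (-κ * x)

namespace IsSolution

variable {a : ℝ → ℝ} {s : ℂ} {ψ p θ q : ℝ → ℂ}

/- The Wronskian is constant and integrable over a set of infinite measure. -/
theorem wronskian_eq_zero_of_memLp (h : IsSolution a s ψ p) (H : IsSolution a s θ q) {A : Set ℝ}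
    (hA : volume A = ⊤) (hψ : MemLp ψ 2 (volume.restrict A)) (hp : MemLp p 2 (volume.restrict A))
    (hθ : MemLp θ 2 (volume.restrict A)) (hq : MemLp q 2 (volume.restrict A)) (x : ℝ) :
    ψ x * q x - θ x * p x = 0 := by
  have hInt : IntegrableOn (fun _ : ℝ => ψ x * q x - θ x * p x) A :=
    ((hψ.integrable_mul hq).sub (hθ.integrable_mul hp)).congr
      (.of_forall fun y => h.wronskian_eq H y x)
  by_contra h0
  rw [IntegrableOn, integrable_const_iff_isFiniteMeasure h0,
    isFiniteMeasure_restrict] at hInt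
  exact hInt hA

end IsSolution

namespace IsDecayingPair

variable {a : ℝ → ℝ} {s : ℂ} {κ : ℝ} {θL pL θR pR : ℝ → ℂ}

theorem eq_zero_of_memLp (h : IsDecayingPair a s κ θL pL θR pR) (hκ : 0 < κ)
    (hW : ∀ x, θL x * pR x - θR x * pL x ≠ 0) {ψ p : ℝ → ℂ} (H : IsSolution a s ψ p)
    (hψ : MemLp ψ 2) (hp : MemLp p 2) (x : ℝ) : ψ x = 0 := by
  have hL := H.wronskian_eq_zero_of_memLp h.left Real.volume_Iic (hψ.restrict _) (hp.restrict _)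
    (memLp_Iic_of_isBigO_exp hκ h.left.continuous h.isBigO_left 0)
    (memLp_Iic_of_isBigO_exp hκ h.left.continuous_flux h.isBigO_left_flux 0) x
  have hR := H.wronskian_eq_zero_of_memLp h.right Real.volume_Ioi (hψ.restrict _) (hp.restrict _)
    (memLp_Ioi_of_isBigO_exp hκ h.right.continuous h.isBigO_right 0)
    (memLp_Ioi_of_isBigO_exp hκ h.right.continuous_flux h.isBigO_right_flux 0) x
  refine (mul_eq_zero.1 ?_).resolve_right (hW x)
  linear_combination θL x * hR - θR x * hL

theorem eq_zero_of_divGraph (h : IsDecayingPair a s κ θL pL θR pR) (hκ : 0 < κ)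
    (hW : ∀ x, θL x * pR x - θR x * pL x ≠ 0) {m M : ℝ} (ha : IsUniformlyElliptic a m M) {u : L2}
    (hu : DivGraph a u (-s ^ 2 • u)) : u = 0 := by
  obtain ⟨w, huw, haw⟩ := hu
  have haw' := haw.congr_ae .rfl (G := fun x => s ^ 2 * u x) <| by
    filter_upwards [Lp.coeFn_smul (-s ^ 2) u] with x hx
    rw [hx, Pi.smul_apply, smul_eq_mul, neg_mul, neg_neg]
  obtain ⟨ψ, p, huψ, hawp, hsol⟩ := exists_isSolution_of_hasWeakDeriv ha.ne_zero huw haw'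
  have hψ : MemLp ψ 2 := (Lp.memLp u).ae_eq huψ
  have hp : MemLp p 2 := (ha.memLp_mul (Lp.memLp w)).ae_eq hawp
  rw [Lp.eq_zero_iff_ae_eq_zero]
  filter_upwards [huψ] with x hx
  rw [hx, h.eq_zero_of_memLp hκ hW hsol hψ hp, Pi.zero_apply]

theorem exists_divGraph (h : IsDecayingPair a s κ θL pL θR pR) (hκ : 0 < κ) {W : ℂ}
    (hW0 : W ≠ 0) (hW : ∀ x, θL x * pR x - θR x * pL x = W) {m M : ℝ}
    (ha : IsUniformlyElliptic a m M) :
    ∃ R : L2 →L[ℂ] L2, (∀ v, DivGraph a (R v) (-s ^ 2 • R v + v)) ∧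
      ∀ v, R v =ᵐ[volume] fun x => -W⁻¹ * ∫ y, greenKernel θR θL θL θR x y * v y := by
  obtain ⟨C, hK⟩ := exists_isSchurKernel_greenKernel hκ h.right.continuous h.left.continuous
    h.left.continuous h.right.continuous h.isBigO_right h.isBigO_left h.isBigO_left h.isBigO_right
  obtain ⟨C', hK'⟩ := exists_isSchurKernel_greenKernel hκ h.right.continuous_flux
    h.left.continuous h.left.continuous_flux h.right.continuous h.isBigO_right_flux h.isBigO_left
    h.isBigO_left_flux h.isBigO_right
  have hR (v : L2) : ((-W⁻¹) • hK.op) v =ᵐ[volume] fun x =>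
      -W⁻¹ * ∫ y, greenKernel θR θL θL θR x y * v y := by
    filter_upwards [Lp.coeFn_smul (-W⁻¹) (hK.op v), hK.coeFn_op v] with x hsmul hop
    rw [_root_.smul_apply, hsmul, Pi.smul_apply, hop, smul_eq_mul]
  refine ⟨(-W⁻¹) • hK.op, fun v => ?_, hR⟩
  have hLv (x : ℝ) : IntegrableOn (fun y => θL y * v y) (Iic x) :=
    (memLp_Iic_of_isBigO_exp hκ h.left.continuous h.isBigO_left x).integrable_mul
      ((Lp.memLp v).restrict _)
  have hRv (x : ℝ) : IntegrableOn (fun y => θR y * v y) (Ioi x) :=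
    (memLp_Ioi_of_isBigO_exp hκ h.right.continuous h.isBigO_right x).integrable_mul
      ((Lp.memLp v).restrict _)
  have hψ := (isPrimitive_greenKernel h.right.isPrimitive h.left.isPrimitive hLv hRv).const_mul
    (-W⁻¹)
  have hp := (isPrimitive_greenKernel h.right.isPrimitive_flux h.left.isPrimitive_flux hLv
    hRv).const_mul (-W⁻¹)
  refine ha.divGraph_of_isPrimitive (hψ.congr_ae (.of_forall fun x => ?_)) hp
    ((hK'.memLp v).const_mul (-W⁻¹)) (hR v) ?_
  · ring
  filter_upwards [hR v, Lp.coeFn_add (-s ^ 2 • ((-W⁻¹) • hK.op) v) v,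
    Lp.coeFn_smul (-s ^ 2) (((-W⁻¹) • hK.op) v)] with x hRx hadd hsmul
  have hWx : pR x * θL x - pL x * θR x = W := by
    rw [← hW x]
    ring
  rw [hadd, Pi.add_apply, hsmul, Pi.smul_apply, hRx, hWx, smul_eq_mul]
  field_simp

theorem exists_resolvent (h : IsDecayingPair a s κ θL pL θR pR) (hκ : 0 < κ) {W : ℂ}
    (hW0 : W ≠ 0) (hW : ∀ x, θL x * pR x - θR x * pL x = W) {m M : ℝ}
    (ha : IsUniformlyElliptic a m M) :
    ∃ R : L2 →L[ℂ] L2, (∀ u v, R v = u ↔ DivGraph a u (-s ^ 2 • u + v)) ∧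
      ∀ v, R v =ᵐ[volume] fun x => -W⁻¹ * ∫ y, greenKernel θR θL θL θR x y * v y := by
  obtain ⟨R, hgraph, hR⟩ := h.exists_divGraph hκ hW0 hW ha
  refine ⟨R, fun u v => ⟨fun huv => huv ▸ hgraph v, fun hu => ?_⟩, hR⟩
  refine sub_eq_zero.1 (h.eq_zero_of_divGraph hκ (fun x => hW x ▸ hW0) ha ?_)
  simpa only [add_sub_add_right_eq_sub, ← smul_sub] using (hgraph v).sub hu

end IsDecayingPair

theorem IsSchurKernel.exists_differentiable_op_indicator {α : Type*} [MeasurableSpace α]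
    {μ : Measure α} [SFinite μ] {K : ℂ → α → α → ℂ}
    (hK : ∀ z, Measurable (Function.uncurry (K z)))
    (hd : ∀ x y, Differentiable ℂ fun z => K z x y) {A : Set α} (hA : MeasurableSet A)
    (hμA : μ A ≠ ⊤)
    (hb : ∀ z₀, ∃ M : ℝ, ∀ z ∈ Metric.closedBall z₀ 1, ∀ x ∈ A, ∀ y ∈ A, ‖K z x y‖ ≤ M) :
    ∃ B : ℂ → Lp ℂ 2 μ →L[ℂ] Lp ℂ 2 μ, Differentiable ℂ B ∧
      ∀ z v, B z v =ᵐ[μ] A.indicator fun x => ∫ y in A, K z x y * v y ∂μ := by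
  classical
  have hdiff (x y : α) :
      Differentiable ℂ fun z => (A ×ˢ A).indicator (Function.uncurry (K z)) (x, y) := by
    by_cases h : (x, y) ∈ A ×ˢ A
    · simpa only [indicator_of_mem h, Function.uncurry_apply_pair] using hd x y
    · simpa only [indicator_of_notMem h] using differentiable_const 0
  have hbound (z₀ : ℂ) : ∃ M : ℝ, ∀ z ∈ Metric.closedBall z₀ 1, ∀ x y,
      ‖(A ×ˢ A).indicator (Function.uncurry (K z)) (x, y)‖ ≤ M := by
    obtain ⟨M, hM⟩ := hb z₀
    refine ⟨|M|, fun z hz x y => ?_⟩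
    by_cases h : (x, y) ∈ A ×ˢ A
    · rw [indicator_of_mem h]
      exact (hM z hz x h.1 y h.2).trans (le_abs_self M)
    · rw [indicator_of_notMem h, norm_zero]
      exact abs_nonneg M
  obtain ⟨B, hB, hBv⟩ := exists_differentiable_op
    (K := fun z x y => (A ×ˢ A).indicator (Function.uncurry (K z)) (x, y))
    (fun z => (hK z).indicator (hA.prod hA)) hdiff hbound hμA fun z x y hxy =>
      indicator_of_notMem (fun h => hxy.elim (· h.1) (· h.2)) _
  refine ⟨B, hB, fun z v => (hBv z v).trans (.of_forall fun x => ?_)⟩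
  by_cases hx : x ∈ A
  · simp only [indicator_of_mem hx, ← integral_indicator hA]
    congr! 2 with y
    by_cases hy : y ∈ A <;> simp [hx, hy]
  · simp [hx]

theorem exists_differentiable_greenKernel_op {θL θR : ℂ → ℝ → ℂ}
    (hL : Continuous (Function.uncurry θL)) (hR : Continuous (Function.uncurry θR))
    (dL : ∀ x, Differentiable ℂ fun s => θL s x) (dR : ∀ x, Differentiable ℂ fun s => θR s x)
    {A : Set ℝ} (hA : IsCompact A) :
    ∃ B : ℂ → L2 →L[ℂ] L2, Differentiable ℂ B ∧ ∀ s v, B s v =ᵐ[volume]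
      A.indicator fun x => ∫ y in A, greenKernel (θR s) (θL s) (θL s) (θR s) x y * v y := by
  have cL (s : ℂ) : Continuous (θL s) := by fun_prop
  have cR (s : ℂ) : Continuous (θR s) := by fun_prop
  refine IsSchurKernel.exists_differentiable_op_indicator (fun s => measurable_greenKernel
    (cR s).measurable (cL s).measurable (cL s).measurable (cR s).measurable) (fun x y => ?_)
    hA.measurableSet hA.measure_ne_top fun s₀ => ?_
  · unfold greenKernel
    split_ifs
    · exact (dR x).mul (dL y)
    · exact (dL x).mul (dR y)
  · have hcompact := (isCompact_closedBall s₀ 1).prod hA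
    obtain ⟨ML, hML⟩ := hcompact.exists_bound_of_continuousOn hL.continuousOn
    obtain ⟨MR, hMR⟩ := hcompact.exists_bound_of_continuousOn hR.continuousOn
    have hmul {s : ℂ} (hs : s ∈ Metric.closedBall s₀ 1) {x y : ℝ} (hx : x ∈ A) (hy : y ∈ A) :
        ‖θL s x‖ * ‖θR s y‖ ≤ ML * MR :=
      mul_le_mul (hML (s, x) ⟨hs, hx⟩) (hMR (s, y) ⟨hs, hy⟩) (norm_nonneg _)
        ((norm_nonneg _).trans (hML (s, x) ⟨hs, hx⟩))
    refine ⟨ML * MR, fun s hs x hx y hy => ?_⟩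
    unfold greenKernel
    split_ifs
    · rw [norm_mul, mul_comm]
      exact hmul hs hy hx
    · rw [norm_mul]
      exact hmul hs hx hy

theorem cutoff_apply_cutoff_ae_eq {R : L2 →L[ℂ] L2} {K : ℝ → ℝ → ℂ} {c : ℂ}
    (hR : ∀ v, R v =ᵐ[volume] fun x => c * ∫ y, K x y * v y) (N : ℝ) (v : L2) :
    cutoff N (R (cutoff N v)) =ᵐ[volume]
      (Icc (-N) N).indicator fun x => c * ∫ y in Icc (-N) N, K x y * v y := by
  have hcut (u : L2) : cutoff N u =ᵐ[volume] (Icc (-N) N).indicator u := cutoffFun_coeFn N u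
  filter_upwards [hcut (R (cutoff N v)), hR (cutoff N v)] with x hx hRx
  rw [hx]
  by_cases hxN : x ∈ Icc (-N) N
  · rw [indicator_of_mem hxN, indicator_of_mem hxN, hRx, ← integral_indicator measurableSet_Icc]
    congr 1
    refine integral_congr_ae ?_
    filter_upwards [hcut v] with y hy
    by_cases hyN : y ∈ Icc (-N) N <;> simp [hy, hyN]
  · rw [indicator_of_notMem hxN, indicator_of_notMem hxN]

/- Apply `T` to the function `g₁⁻¹` on `J`. -/
theorem ne_zero_of_ae_eq_greenKernel {f₁ g₁ f₂ g₂ : ℝ → ℂ} {A I J : Set ℝ} (hIA : I ⊆ A)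
    (hJA : J ⊆ A) (hI : volume I ≠ 0) (hJ : volume J ≠ 0) (hJc : IsCompact J)
    (hJI : ∀ x ∈ I, ∀ y ∈ J, y ≤ x) (hf : ∀ x ∈ I, f₁ x ≠ 0) (hg : ContinuousOn g₁ J)
    (hg₀ : ∀ y ∈ J, g₁ y ≠ 0) {T : L2 →L[ℂ] L2} (hT : ∀ v, T v =ᵐ[volume]
      A.indicator fun x => ∫ y in A, greenKernel f₁ g₁ f₂ g₂ x y * v y) : T ≠ 0 := by
  rintro rfl
  have hv : MemLp (J.indicator g₁⁻¹) 2 := by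
    rw [memLp_indicator_iff_restrict hJc.measurableSet]
    exact memLp_restrict_of_continuousOn hJc (hg.inv₀ hg₀) 2
  have hInt {x : ℝ} (hx : x ∈ I) :
      ∫ y in A, greenKernel f₁ g₁ f₂ g₂ x y * hv.toLp _ y = volume.real J * f₁ x := by
    have hae : ∀ᵐ y, greenKernel f₁ g₁ f₂ g₂ x y * hv.toLp _ y = J.indicator (fun _ => f₁ x) y := by
      filter_upwards [hv.coeFn_toLp] with y hy
      rw [hy]
      by_cases hyJ : y ∈ J
      · simp [hyJ, greenKernel, hJI x hx y hyJ, hg₀ y hyJ]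
      · simp [hyJ]
    rw [integral_congr_ae (ae_restrict_of_ae hae), setIntegral_indicator hJc.measurableSet,
      inter_eq_right.2 hJA, setIntegral_const, real_smul]
  have hzero : ∀ᵐ x, x ∉ I := by
    filter_upwards [hT (hv.toLp _), Lp.coeFn_zero ℂ 2 (volume : Measure ℝ)] with x hx h0 hxI
    rw [_root_.zero_apply, h0, indicator_of_mem (hIA hxI), hInt hxI] at hx
    have hJ' : volume.real J ≠ 0 := (measureReal_ne_zero_iff hJc.measure_ne_top).2 hJ
    exact mul_ne_zero (ofReal_ne_zero.2 hJ') (hf x hxI) hx.symm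
  exact hI (measure_eq_zero_iff_ae_notMem.2 hzero)

/-! ### Orders of meromorphic functions -/

theorem meromorphicOrderAt_inv_smul_neg {E : Type*} [NormedAddCommGroup E] [NormedSpace ℂ E]
    {f : ℂ → ℂ} {g : ℂ → E} {z : ℂ} (hf : AnalyticAt ℂ f z) (hg : AnalyticAt ℂ g z)
    (hf0 : f z = 0) (hft : meromorphicOrderAt f z ≠ ⊤) (hg0 : g z ≠ 0) :
    meromorphicOrderAt (fun w => (f w)⁻¹ • g w) z < 0 := by
  have hf_pos : 0 < meromorphicOrderAt f z := by
    rw [← tendsto_zero_iff_meromorphicOrderAt_pos hf.meromorphicAt, ← hf0]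
    exact hf.continuousAt.tendsto.mono_left nhdsWithin_le_nhds
  have hg_zero : meromorphicOrderAt g z = 0 := by
    rw [← tendsto_ne_zero_iff_meromorphicOrderAt_eq_zero hg.meromorphicAt]
    exact ⟨g z, hg0, hg.continuousAt.tendsto.mono_left nhdsWithin_le_nhds⟩
  have hsmul : meromorphicOrderAt (fun w => (f w)⁻¹ • g w) z =
      meromorphicOrderAt (f⁻¹) z + meromorphicOrderAt g z :=
    meromorphicOrderAt_smul hf.meromorphicAt.inv hg.meromorphicAt
  rw [hsmul, hg_zero, add_zero, meromorphicOrderAt_inv]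
  lift meromorphicOrderAt f z to ℤ using hft with n
  norm_cast at hf_pos ⊢
  exact neg_lt_zero.2 hf_pos

theorem eventuallyEq_of_meromorphicOn {E : Type*} [NormedAddCommGroup E] [NormedSpace ℂ E]
    {f g : ℂ → E} (hf : MeromorphicOn f univ) (hg : MeromorphicOn g univ) {w : ℂ}
    (hw : f =ᶠ[𝓝 w] g) (z : ℂ) : f =ᶠ[𝓝[≠] z] g := by
  have hw' : meromorphicOrderAt (f - g) w = ⊤ := by
    rw [meromorphicOrderAt_eq_top_iff]
    filter_upwards [hw.filter_mono nhdsWithin_le_nhds] with y hy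
    rw [Pi.sub_apply, hy, sub_self]
  have hz : meromorphicOrderAt (f - g) z = ⊤ := by
    by_contra hne
    exact (hf.sub hg).meromorphicOrderAt_ne_top_of_isPreconnected isPreconnected_univ
      (mem_univ z) (mem_univ w) hne hw'
  filter_upwards [meromorphicOrderAt_eq_top_iff.1 hz] with y hy
  exact sub_eq_zero.1 hy

theorem meromorphicOrderAt_ne_top_of_differentiable {f : ℂ → ℂ} (hf : Differentiable ℂ f) {w : ℂ}
    (hw : f w ≠ 0) (z : ℂ) : meromorphicOrderAt f z ≠ ⊤ := by
  have hm : MeromorphicOn f univ := fun z _ => (hf.analyticAt z).meromorphicAt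
  refine hm.meromorphicOrderAt_ne_top_of_isPreconnected isPreconnected_univ (mem_univ w)
    (mem_univ z) ?_
  rw [(hf.analyticAt w).meromorphicOrderAt_eq, (hf.analyticAt w).analyticOrderAt_eq_zero.2 hw]
  simp

/-! ### The finite periodic medium -/

section Medium

variable {b₁ b₂ x₂ : ℝ} {k : ℕ}

theorem layerB_pos (hb₁ : 0 < b₁) (hb₂ : 0 < b₂) (n : ℕ) : 0 < layerB b₁ b₂ n := by
  unfold layerB
  split_ifs <;> assumption

theorem layerB_two_mul (n : ℕ) : layerB b₁ b₂ (2 * n) = b₂ := by simp [layerB]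

theorem layerB_two_mul_add_one (n : ℕ) : layerB b₁ b₂ (2 * n + 1) = b₁ := by simp [layerB]

theorem layerX_two_mul (n : ℕ) : layerX x₂ (2 * n) = n - 1 + x₂ := by simp [layerX]

theorem layerX_two_mul_add_one (n : ℕ) : layerX x₂ (2 * n + 1) = n := by simp [layerX]

theorem monotone_layerX (hx₀ : 0 < x₂) (hx₁ : x₂ < 1) : Monotone (layerX x₂) := by
  refine monotone_nat_of_le_succ fun n => ?_
  obtain ⟨m, rfl | rfl⟩ := Nat.even_or_odd' n
  · rw [layerX_two_mul, layerX_two_mul_add_one]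
    linarith
  · rw [show 2 * m + 1 + 1 = 2 * (m + 1) by ring, layerX_two_mul, layerX_two_mul_add_one]
    push_cast
    linarith

/-- The union of the slabs `[j, j + x₂)`, `j < k`, on which the coefficient `a_k` is `b₂⁻²`. -/
def slabs (x₂ : ℝ) (k : ℕ) : Set ℝ := {y | ∃ j < k, y ∈ Ico (j : ℝ) (j + x₂)}

theorem coeff_of_mem_slabs (hx₁ : x₂ < 1) {y : ℝ} (hy : y ∈ slabs x₂ k) :
    coeff b₁ b₂ x₂ k y = (b₂ ^ 2)⁻¹ := by
  obtain ⟨j, hj, hjy, hyj⟩ := hy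
  have hjk : (j : ℝ) + 1 ≤ k := by exact_mod_cast hj
  have hfloor : ⌊y⌋ = j := Int.floor_eq_iff.2 ⟨by simpa using hjy, by push_cast; linarith⟩
  have hfract : Int.fract y < x₂ := by
    rw [Int.fract, hfloor, Int.cast_natCast]
    linarith
  rw [coeff, if_pos ⟨j.cast_nonneg.trans hjy, by linarith⟩, unitCell, if_pos hfract]

theorem coeff_of_notMem_slabs {y : ℝ} (hy : y ∉ slabs x₂ k) :
    coeff b₁ b₂ x₂ k y = (b₁ ^ 2)⁻¹ := by
  rw [coeff, ite_eq_right_iff]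
  rintro ⟨hy₀, hyk⟩
  refine if_neg fun hfract => hy ⟨⌊y⌋₊, (Nat.floor_lt hy₀).2 hyk, Nat.floor_le hy₀, ?_⟩
  rw [Int.fract, ← natCast_floor_eq_intCast_floor hy₀] at hfract
  linarith

theorem coeff_eq_coeff_of_iff (hx₁ : x₂ < 1) {k' : ℕ} {y y' : ℝ}
    (h : y ∈ slabs x₂ k ↔ y' ∈ slabs x₂ k') : coeff b₁ b₂ x₂ k y = coeff b₁ b₂ x₂ k' y' := by
  by_cases hy : y ∈ slabs x₂ k
  · rw [coeff_of_mem_slabs hx₁ hy, coeff_of_mem_slabs hx₁ (h.1 hy)]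
  · rw [coeff_of_notMem_slabs hy, coeff_of_notMem_slabs (mt h.2 hy)]

theorem coeff_eq_stepCoeff (hx₁ : x₂ < 1) (y : ℝ) :
    coeff b₁ b₂ x₂ k y = stepCoeff (layerB b₁ b₂) (layerX x₂) (2 * k) y := by
  induction k with
  | zero =>
    rw [coeff_of_notMem_slabs (by simp [slabs]), stepCoeff, layered, ← mul_zero 2,
      layerB_two_mul_add_one]
  | succ k ih =>
    have hX : layerX x₂ (2 * k + 1 + 1) = k + x₂ := by
      rw [show 2 * k + 1 + 1 = 2 * (k + 1) by ring, layerX_two_mul]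
      push_cast
      ring
    have hB : layerB b₁ b₂ (2 * k + 1 + 1) = b₂ := layerB_two_mul (k + 1)
    have hB' : layerB b₁ b₂ (2 * k + 1 + 1 + 1) = b₁ := layerB_two_mul_add_one (k + 1)
    rw [stepCoeff, show 2 * (k + 1) = 2 * k + 1 + 1 by ring, layered, layered, ← stepCoeff, ← ih,
      layerX_two_mul_add_one, hX, hB, hB']
    split_ifs with hy hy'
    · refine coeff_eq_coeff_of_iff hx₁ ⟨?_, fun ⟨j, hj, hjy⟩ => ⟨j, hj.trans k.lt_succ_self, hjy⟩⟩
      rintro ⟨j, -, hjy⟩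
      exact ⟨j, by exact_mod_cast hjy.1.trans_lt hy', hjy⟩
    · exact coeff_of_mem_slabs hx₁ ⟨k, k.lt_succ_self, not_lt.1 hy', hy⟩
    · refine coeff_of_notMem_slabs fun ⟨j, hj, hjy⟩ => hy ?_
      have hjk : (j : ℝ) ≤ k := by exact_mod_cast Nat.lt_succ_iff.1 hj
      linarith [hjy.2]

theorem isUniformlyElliptic_coeff (hb₁ : 0 < b₁) (hb₂ : 0 < b₂) :
    IsUniformlyElliptic (coeff b₁ b₂ x₂ k) (min (b₁ ^ 2)⁻¹ (b₂ ^ 2)⁻¹)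
      (max (b₁ ^ 2)⁻¹ (b₂ ^ 2)⁻¹) where
  measurable := by
    refine Measurable.ite (measurableSet_Ici.inter measurableSet_Iio) (Measurable.ite ?_
      measurable_const measurable_const) measurable_const
    exact measurableSet_lt measurable_fract measurable_const
  pos := by positivity
  le x := by
    unfold coeff unitCell
    split_ifs <;> simp
  ge x := by
    unfold coeff unitCell
    split_ifs <;> simp

/-- The right end of the last layer with coefficient `b₂⁻²`. -/
def rightEnd (x₂ : ℝ) (k : ℕ) : ℝ := k - 1 + x₂

theorem rightEnd_pos (hx₀ : 0 < x₂) (hk : 1 ≤ k) : 0 < rightEnd x₂ k := by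
  have : (1 : ℝ) ≤ k := by exact_mod_cast hk
  unfold rightEnd
  linarith

theorem rightEnd_sub_mem_slabs {y : ℝ} (hy : y ∈ slabs x₂ k) (hy' : y ∉ range ((↑) : ℕ → ℝ)) :
    rightEnd x₂ k - y ∈ slabs x₂ k := by
  obtain ⟨j, hj, hjy, hyj⟩ := hy
  have hjy' : (j : ℝ) < y := hjy.lt_of_ne fun h => hy' ⟨j, h⟩
  have hcast : ((k - 1 - j : ℕ) : ℝ) = k - 1 - j := by
    rw [Nat.cast_sub (by lia), Nat.cast_sub (by lia), Nat.cast_one]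
  refine ⟨k - 1 - j, by lia, ?_, ?_⟩ <;> rw [hcast, rightEnd] <;> linarith

/- The medium is symmetric about the midpoint of `[0, k - 1 + x₂]`, up to interface points. -/
theorem coeff_rightEnd_sub_ae_eq (hx₁ : x₂ < 1) :
    (fun y => coeff b₁ b₂ x₂ k (rightEnd x₂ k - y)) =ᵐ[volume] coeff b₁ b₂ x₂ k := by
  have hcount : (range ((↑) : ℕ → ℝ)).Countable := countable_range _
  have hae := hcount.ae_notMem volume
  filter_upwards [hae, (volume.measurePreserving_sub_left (rightEnd x₂ k)).quasiMeasurePreserving.ae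
    hae] with y hy hy'
  refine coeff_eq_coeff_of_iff hx₁ ⟨fun h => ?_, fun h => rightEnd_sub_mem_slabs h hy⟩
  simpa using rightEnd_sub_mem_slabs h hy'

variable (b₁ b₂ x₂ k)

/-- The Jost solution equal to `e^{s b₁ y}` on the left of the medium. -/
def jostL (s : ℂ) : ℝ → ℂ := jost (layerB b₁ b₂) (layerX x₂) s (2 * k)

/-- The flux of `jostL`. -/
def fluxL (s : ℂ) : ℝ → ℂ := jostFlux (layerB b₁ b₂) (layerX x₂) s (2 * k)

/-- The mirror image of `jostL`: the Jost solution equal to a multiple of `e^{-s b₁ y}` on the right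
of the medium. -/
def jostR (s : ℂ) (y : ℝ) : ℂ := jostL b₁ b₂ x₂ k s (rightEnd x₂ k - y)

/-- The flux of `jostR`. -/
def fluxR (s : ℂ) (y : ℝ) : ℂ := -fluxL b₁ b₂ x₂ k s (rightEnd x₂ k - y)

/-- The normalization of `jostL` on the right of the medium. -/
def rightNorm : ℝ := layerNorm (layerB b₁ b₂) (2 * k)

/-- The Wronskian of `jostL` and `jostR`. -/
def wronskian (s : ℂ) : ℂ :=
  -2 * (s / b₁) * rightNorm b₁ b₂ k * exp (s * b₁ * rightEnd x₂ k) *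
    detD b₁ b₂ x₂ (2 * k + 1) s

variable {b₁ b₂ x₂ k}

theorem rightNorm_ne_zero (hb₁ : 0 < b₁) (hb₂ : 0 < b₂) : (rightNorm b₁ b₂ k : ℂ) ≠ 0 :=
  ofReal_ne_zero.2 (layerNorm_ne_zero (layerB_pos hb₁ hb₂) _)

theorem layerPair_two_mul (hk : 1 ≤ k) (s : ℂ) :
    layerPair (layerB b₁ b₂) (layerX x₂) s (2 * k) =
      (detD b₁ b₂ x₂ (2 * k + 1) s, detDtilde b₁ b₂ x₂ (2 * k + 1) s) := by
  obtain ⟨m, rfl⟩ := Nat.exists_eq_add_of_le' hk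
  rfl

theorem differentiable_detD_detDtilde (hk : 1 ≤ k) :
    Differentiable ℂ (detD b₁ b₂ x₂ (2 * k + 1)) ∧
      Differentiable ℂ (detDtilde b₁ b₂ x₂ (2 * k + 1)) := by
  simpa only [layerPair_two_mul hk] using
    differentiable_layerPair (b := layerB b₁ b₂) (x := layerX x₂) (2 * k)

theorem detD_ne_zero (hb₁ : 0 < b₁) (hb₂ : 0 < b₂) (hx₀ : 0 < x₂) (hx₁ : x₂ < 1) (hk : 1 ≤ k)
    {s : ℂ} (hs : 0 ≤ s.re) : detD b₁ b₂ x₂ (2 * k + 1) s ≠ 0 := by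
  simpa only [layerPair_two_mul hk] using
    layerPair_fst_ne_zero s (layerB_pos hb₁ hb₂) (monotone_layerX hx₀ hx₁) hs (2 * k)

theorem detDtilde_ne_zero_of_detD_eq_zero (hb₁ : 0 < b₁) (hb₂ : 0 < b₂) (hk : 1 ≤ k)
    {s : ℂ} (h : detD b₁ b₂ x₂ (2 * k + 1) s = 0) : detDtilde b₁ b₂ x₂ (2 * k + 1) s ≠ 0 := by
  intro h'
  refine layerPair_ne_zero (x := layerX x₂) s (layerB_pos hb₁ hb₂) (2 * k) ?_
  rw [layerPair_two_mul hk, h, h', Prod.mk_zero_zero]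

theorem isSolution_jostL (hb₁ : 0 < b₁) (hb₂ : 0 < b₂) (hx₀ : 0 < x₂) (hx₁ : x₂ < 1) (s : ℂ) :
    IsSolution (coeff b₁ b₂ x₂ k) s (jostL b₁ b₂ x₂ k s) (fluxL b₁ b₂ x₂ k s) :=
  (isSolution_jost s (layerB_pos hb₁ hb₂) (monotone_layerX hx₀ hx₁) (2 * k)).congr_coeff
    (.of_forall fun y => (coeff_eq_stepCoeff hx₁ y).symm)

theorem isSolution_jostR (hb₁ : 0 < b₁) (hb₂ : 0 < b₂) (hx₀ : 0 < x₂) (hx₁ : x₂ < 1) (s : ℂ) :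
    IsSolution (coeff b₁ b₂ x₂ k) s (jostR b₁ b₂ x₂ k s) (fluxR b₁ b₂ x₂ k s) :=
  ((isSolution_jostL hb₁ hb₂ hx₀ hx₁ s).comp_sub_left (rightEnd x₂ k)).congr_coeff
    (coeff_rightEnd_sub_ae_eq hx₁)

theorem jostL_of_neg (hx₀ : 0 < x₂) (hx₁ : x₂ < 1) (s : ℂ) {y : ℝ} (hy : y < 0) :
    jostL b₁ b₂ x₂ k s y = exp (s * b₁ * y) := by
  rw [jostL, jost, layered_of_lt (monotone_layerX hx₀ hx₁) (by simpa [layerX] using hy)]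
  simp [layerSol, leftWave, rightWave, layerNorm, layerPair, layerB]

theorem fluxL_of_neg (hx₀ : 0 < x₂) (hx₁ : x₂ < 1) (s : ℂ) {y : ℝ} (hy : y < 0) :
    fluxL b₁ b₂ x₂ k s y = s / b₁ * exp (s * b₁ * y) := by
  rw [fluxL, jostFlux, layered_of_lt (monotone_layerX hx₀ hx₁) (by simpa [layerX] using hy)]
  simp [layerFlux, leftWave, rightWave, layerNorm, layerPair, layerB]

theorem jostL_of_le (hk : 1 ≤ k) (s : ℂ) {y : ℝ} (hy : rightEnd x₂ k ≤ y) :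
    jostL b₁ b₂ x₂ k s y = rightNorm b₁ b₂ k *
      (detD b₁ b₂ x₂ (2 * k + 1) s * exp (s * b₁ * y) -
        detDtilde b₁ b₂ x₂ (2 * k + 1) s * exp (-s * b₁ * y)) := by
  rw [jostL, jost, layered_of_le (by rwa [layerX_two_mul]), layerSol, leftWave, rightWave,
    layerPair_two_mul hk, layerB_two_mul_add_one, rightNorm]

theorem fluxL_of_le (hk : 1 ≤ k) (s : ℂ) {y : ℝ} (hy : rightEnd x₂ k ≤ y) :
    fluxL b₁ b₂ x₂ k s y = rightNorm b₁ b₂ k * (s / b₁) *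
      (detD b₁ b₂ x₂ (2 * k + 1) s * exp (s * b₁ * y) +
        detDtilde b₁ b₂ x₂ (2 * k + 1) s * exp (-s * b₁ * y)) := by
  rw [fluxL, jostFlux, layered_of_le (by rwa [layerX_two_mul]), layerFlux, leftWave, rightWave,
    layerPair_two_mul hk, layerB_two_mul_add_one, rightNorm]

theorem jostR_of_lt (hx₀ : 0 < x₂) (hx₁ : x₂ < 1) (s : ℂ) {y : ℝ} (hy : rightEnd x₂ k < y) :
    jostR b₁ b₂ x₂ k s y = exp (s * b₁ * rightEnd x₂ k) * exp (-s * b₁ * y) := by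
  rw [jostR, jostL_of_neg hx₀ hx₁ s (sub_neg.2 hy), ← exp_add]
  congr 1
  push_cast
  ring

theorem fluxR_of_lt (hx₀ : 0 < x₂) (hx₁ : x₂ < 1) (s : ℂ) {y : ℝ} (hy : rightEnd x₂ k < y) :
    fluxR b₁ b₂ x₂ k s y =
      -(s / b₁ * (exp (s * b₁ * rightEnd x₂ k) * exp (-s * b₁ * y))) := by
  rw [fluxR, fluxL_of_neg hx₀ hx₁ s (sub_neg.2 hy), ← exp_add]
  congr 3
  push_cast
  ring

theorem jostR_of_neg (hk : 1 ≤ k) (s : ℂ) {y : ℝ} (hy : y < 0) :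
    jostR b₁ b₂ x₂ k s y = rightNorm b₁ b₂ k *
      (detD b₁ b₂ x₂ (2 * k + 1) s * exp (s * b₁ * rightEnd x₂ k) * exp (-s * b₁ * y) -
        detDtilde b₁ b₂ x₂ (2 * k + 1) s * exp (-s * b₁ * rightEnd x₂ k) * exp (s * b₁ * y)) := by
  have hexp (c : ℂ) : exp (c * ((rightEnd x₂ k - y : ℝ) : ℂ)) =
      exp (c * rightEnd x₂ k) * exp (-c * y) := by
    rw [← exp_add]
    congr 1
    push_cast
    ring
  rw [jostR, jostL_of_le hk s (by linarith), hexp, hexp, neg_mul s, neg_neg]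
  ring

theorem wronskian_eq (hb₁ : 0 < b₁) (hb₂ : 0 < b₂) (hx₀ : 0 < x₂) (hx₁ : x₂ < 1) (hk : 1 ≤ k)
    (s : ℂ) (y : ℝ) :
    jostL b₁ b₂ x₂ k s y * fluxR b₁ b₂ x₂ k s y - jostR b₁ b₂ x₂ k s y * fluxL b₁ b₂ x₂ k s y =
      wronskian b₁ b₂ x₂ k s := by
  have hlt : rightEnd x₂ k < rightEnd x₂ k + 1 := lt_add_one _
  have hexp (c : ℂ) : exp (s * b₁ * c) * exp (-s * b₁ * c) = 1 := by
    rw [← exp_add, ← exp_zero]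
    congr 1
    ring
  rw [(isSolution_jostL hb₁ hb₂ hx₀ hx₁ s).wronskian_eq (isSolution_jostR hb₁ hb₂ hx₀ hx₁ s) y
    (rightEnd x₂ k + 1), jostL_of_le hk s hlt.le, fluxL_of_le hk s hlt.le,
    jostR_of_lt hx₀ hx₁ s hlt, fluxR_of_lt hx₀ hx₁ s hlt, wronskian]
  linear_combination (-2 * (s / b₁) * rightNorm b₁ b₂ k * exp (s * b₁ * rightEnd x₂ k) *
    detD b₁ b₂ x₂ (2 * k + 1) s) * hexp (rightEnd x₂ k + 1 : ℝ)

theorem wronskian_eq_zero_iff (hb₁ : 0 < b₁) (hb₂ : 0 < b₂) {s : ℂ} (hs : s ≠ 0) :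
    wronskian b₁ b₂ x₂ k s = 0 ↔ detD b₁ b₂ x₂ (2 * k + 1) s = 0 := by
  simp [wronskian, hs, hb₁.ne', rightNorm_ne_zero hb₁ hb₂]

theorem differentiable_wronskian (hk : 1 ≤ k) : Differentiable ℂ (wronskian b₁ b₂ x₂ k) := by
  have := (differentiable_detD_detDtilde (b₁ := b₁) (b₂ := b₂) (x₂ := x₂) hk).1
  unfold wronskian
  fun_prop

theorem continuous_uncurry_jostL (hb₁ : 0 < b₁) (hb₂ : 0 < b₂) (hx₀ : 0 < x₂) (hx₁ : x₂ < 1) :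
    Continuous (Function.uncurry (jostL b₁ b₂ x₂ k)) :=
  continuous_uncurry_jost (layerB_pos hb₁ hb₂) (monotone_layerX hx₀ hx₁) (2 * k)

theorem isBigO_exp_mul (c : ℂ) (l : Filter ℝ) :
    (fun y : ℝ => exp (c * y)) =O[l] fun y => Real.exp (c.re * y) :=
  .of_bound' (.of_forall fun y => by simp [norm_exp])

theorem isBigO_top_of_exp {f : ℝ → ℂ} (hf : Continuous f) {c A B B' : ℂ} (hc : 0 < c.re) {L : ℝ}
    (hL : 0 ≤ L) (hleft : ∀ y < 0, f y = A * exp (c * y))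
    (hright : ∀ y, L ≤ y → f y = B * exp (c * y) + B' * exp (-c * y)) :
    f =O[⊤] fun y => Real.exp (c.re * y) := by
  have hO₁ : f =O[𝓟 (Iio 0)] fun y => Real.exp (c.re * y) :=
    ((isBigO_exp_mul c _).const_mul_left A).congr' (eventually_principal.2
      fun y hy => (hleft y hy).symm) .rfl
  have hO₂ : f =O[𝓟 (Icc 0 L)] fun y => Real.exp (c.re * y) :=
    (hf.continuousOn.isBigO_principal isCompact_Icc (c := (1 : ℝ)) (by simp)).trans
      (ContinuousOn.isBigO_rev_principal (by fun_prop) isCompact_Icc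
        (fun y _ => (Real.exp_pos _).ne') 1)
  have hneg : (fun y : ℝ => exp (-c * y)) =O[𝓟 (Ici L)] fun y => Real.exp (c.re * y) := by
    refine (isBigO_exp_mul (-c) _).trans (.of_bound' (eventually_principal.2 fun y hy => ?_))
    rw [Real.norm_of_nonneg (Real.exp_pos _).le, Real.norm_of_nonneg (Real.exp_pos _).le, neg_re]
    have hy₀ : 0 ≤ y := hL.trans hy
    gcongr
    linarith
  have hO₃ : f =O[𝓟 (Ici L)] fun y => Real.exp (c.re * y) :=
    (((isBigO_exp_mul c _).const_mul_left B).add (hneg.const_mul_left B')).congr'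
      (eventually_principal.2 fun y hy => (hright y hy).symm) .rfl
  have huniv : Iio 0 ∪ Icc 0 L ∪ Ici L = univ := by
    rw [union_assoc, Icc_union_Ici_eq_Ici hL, Iio_union_Ici]
  simpa only [sup_principal, huniv, principal_univ] using (hO₁.sup hO₂).sup hO₃

theorem isBigO_comp_sub_left {f : ℝ → ℂ} {κ : ℝ} (h : f =O[⊤] fun y => Real.exp (κ * y)) (L : ℝ) :
    (fun y => f (L - y)) =O[⊤] fun y => Real.exp (-κ * y) := by
  refine (h.comp_tendsto (k := fun y => L - y) tendsto_top).trans ?_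
  refine ((Asymptotics.isBigO_refl _ _).const_mul_left (Real.exp (κ * L))).congr_left fun y => ?_
  rw [Function.comp_apply, ← Real.exp_add]
  ring_nf

theorem isDecayingPair_jost (hb₁ : 0 < b₁) (hb₂ : 0 < b₂) (hx₀ : 0 < x₂) (hx₁ : x₂ < 1)
    (hk : 1 ≤ k) {s : ℂ} (hs : 0 < s.re) :
    IsDecayingPair (coeff b₁ b₂ x₂ k) s (s * b₁).re (jostL b₁ b₂ x₂ k s) (fluxL b₁ b₂ x₂ k s)
      (jostR b₁ b₂ x₂ k s) (fluxR b₁ b₂ x₂ k s) := by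
  have hre : 0 < (s * b₁).re := by simpa using mul_pos hs hb₁
  have hend := (rightEnd_pos hx₀ hk).le
  have hsol := isSolution_jostL (k := k) hb₁ hb₂ hx₀ hx₁ s
  have hjost : jostL b₁ b₂ x₂ k s =O[⊤] fun y => Real.exp ((s * b₁).re * y) := by
    refine isBigO_top_of_exp hsol.continuous (A := 1) hre hend
      (B := rightNorm b₁ b₂ k * detD b₁ b₂ x₂ (2 * k + 1) s)
      (B' := -(rightNorm b₁ b₂ k * detDtilde b₁ b₂ x₂ (2 * k + 1) s))
      (fun y hy => by rw [jostL_of_neg hx₀ hx₁ s hy, one_mul]) fun y hy => ?_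
    rw [jostL_of_le hk s hy, neg_mul s]
    ring
  have hflux : fluxL b₁ b₂ x₂ k s =O[⊤] fun y => Real.exp ((s * b₁).re * y) := by
    refine isBigO_top_of_exp hsol.continuous_flux hre hend
      (B := rightNorm b₁ b₂ k * (s / b₁) * detD b₁ b₂ x₂ (2 * k + 1) s)
      (B' := rightNorm b₁ b₂ k * (s / b₁) * detDtilde b₁ b₂ x₂ (2 * k + 1) s)
      (fun y hy => fluxL_of_neg hx₀ hx₁ s hy) fun y hy => ?_
    rw [fluxL_of_le hk s hy, neg_mul s]
    ring
  exact ⟨hsol, isSolution_jostR hb₁ hb₂ hx₀ hx₁ s, hjost, hflux, isBigO_comp_sub_left hjost _,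
    (isBigO_comp_sub_left hflux _).neg_left⟩

end Medium

/-! ### Meromorphic continuation of the resolvent -/

section Continuation

variable {b₁ b₂ x₂ : ℝ} {k : ℕ}

theorem IsResolventAt.unique {z : ℂ} {R R' : L2 →L[ℂ] L2} (h : IsResolventAt b₁ b₂ x₂ k z R)
    (h' : IsResolventAt b₁ b₂ x₂ k z R') : R = R' := by
  ext1 v
  exact (h (R' v) v).2 ((h' (R' v) v).1 rfl)

theorem neg_I_mul_ne_zero {z : ℂ} (hz : z ≠ 0) : -I * z ≠ 0 :=
  mul_ne_zero (neg_ne_zero.2 I_ne_zero) hz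

theorem wronskian_neg_I_mul_ne_zero (hb₁ : 0 < b₁) (hb₂ : 0 < b₂) (hx₀ : 0 < x₂) (hx₁ : x₂ < 1)
    (hk : 1 ≤ k) {z : ℂ} (hz : 0 < z.im) : wronskian b₁ b₂ x₂ k (-I * z) ≠ 0 := by
  have hz₀ : z ≠ 0 := fun h => by simp [h] at hz
  rw [Ne, wronskian_eq_zero_iff hb₁ hb₂ (neg_I_mul_ne_zero hz₀)]
  exact detD_ne_zero hb₁ hb₂ hx₀ hx₁ hk (by simpa using hz.le)

theorem exists_isResolventAt (hb₁ : 0 < b₁) (hb₂ : 0 < b₂) (hx₀ : 0 < x₂) (hx₁ : x₂ < 1)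
    (hk : 1 ≤ k) {z : ℂ} (hz : 0 < z.im) :
    ∃ R, IsResolventAt b₁ b₂ x₂ k z R ∧ ∀ v, R v =ᵐ[volume] fun x =>
      -(wronskian b₁ b₂ x₂ k (-I * z))⁻¹ * ∫ y, greenKernel (jostR b₁ b₂ x₂ k (-I * z))
        (jostL b₁ b₂ x₂ k (-I * z)) (jostL b₁ b₂ x₂ k (-I * z))
        (jostR b₁ b₂ x₂ k (-I * z)) x y * v y := by
  have hs : 0 < (-I * z).re := by simpa using hz
  have hsq : -(-I * z) ^ 2 = z ^ 2 := by simp [mul_pow]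
  obtain ⟨R, hR, hRv⟩ := (isDecayingPair_jost hb₁ hb₂ hx₀ hx₁ hk hs).exists_resolvent
    (by simpa using mul_pos hz hb₁) (wronskian_neg_I_mul_ne_zero hb₁ hb₂ hx₀ hx₁ hk hz)
    (wronskian_eq hb₁ hb₂ hx₀ hx₁ hk (-I * z)) (isUniformlyElliptic_coeff hb₁ hb₂)
  rw [hsq] at hR
  exact ⟨R, hR, hRv⟩

variable (b₁ b₂ x₂ k) in
/-- `B s` is the cutoff to `[-N, N]` of the Green operator built from the Jost solutions. -/
def IsCutoffGreen (N : ℝ) (B : ℂ → L2 →L[ℂ] L2) : Prop :=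
  ∀ s v, B s v =ᵐ[volume] (Icc (-N) N).indicator fun x => ∫ y in Icc (-N) N,
    greenKernel (jostR b₁ b₂ x₂ k s) (jostL b₁ b₂ x₂ k s) (jostL b₁ b₂ x₂ k s)
      (jostR b₁ b₂ x₂ k s) x y * v y

theorem exists_differentiable_isCutoffGreen (hb₁ : 0 < b₁) (hb₂ : 0 < b₂) (hx₀ : 0 < x₂)
    (hx₁ : x₂ < 1) (N : ℝ) : ∃ B, Differentiable ℂ B ∧ IsCutoffGreen b₁ b₂ x₂ k N B := by
  have hL : Continuous (Function.uncurry (jostL b₁ b₂ x₂ k)) :=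
    continuous_uncurry_jostL hb₁ hb₂ hx₀ hx₁
  have hR : Continuous (Function.uncurry (jostR b₁ b₂ x₂ k)) :=
    hL.comp (by fun_prop : Continuous fun p : ℂ × ℝ => (p.1, rightEnd x₂ k - p.2))
  exact exists_differentiable_greenKernel_op hL hR (fun y => differentiable_jost _ y)
    (fun y => differentiable_jost _ (rightEnd x₂ k - y)) isCompact_Icc

theorem IsCutoffGreen.isCutoffResolventContinuation {N : ℝ} {B : ℂ → L2 →L[ℂ] L2}
    (h : IsCutoffGreen b₁ b₂ x₂ k N B) (hB : Differentiable ℂ B) (hb₁ : 0 < b₁) (hb₂ : 0 < b₂)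
    (hx₀ : 0 < x₂) (hx₁ : x₂ < 1) (hk : 1 ≤ k) :
    IsCutoffResolventContinuation b₁ b₂ x₂ k N
      fun z => (wronskian b₁ b₂ x₂ k (-I * z))⁻¹ • -B (-I * z) := by
  have hW : Differentiable ℂ fun z => wronskian b₁ b₂ x₂ k (-I * z) :=
    (differentiable_wronskian hk).comp (by fun_prop)
  have hB' : Differentiable ℂ fun z => -B (-I * z) := (hB.comp (by fun_prop)).neg
  refine ⟨fun z _ => (hW.analyticAt z).meromorphicAt.inv.smul (hB'.analyticAt z).meromorphicAt,
    fun z hz => ?_⟩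
  obtain ⟨R, hR, hRv⟩ := exists_isResolventAt hb₁ hb₂ hx₀ hx₁ hk hz
  refine ⟨R, hR, ContinuousLinearMap.ext fun v => Lp.ext ?_⟩
  change ((wronskian b₁ b₂ x₂ k (-I * z))⁻¹ • -(B (-I * z) v) : L2) =ᵐ[volume]
    cutoff N (R (cutoff N v))
  filter_upwards [Lp.coeFn_smul (wronskian b₁ b₂ x₂ k (-I * z))⁻¹ (-(B (-I * z) v)),
    Lp.coeFn_neg (B (-I * z) v), h (-I * z) v, cutoff_apply_cutoff_ae_eq hRv N v]
    with x hsmul hneg hBx hRx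
  rw [hsmul, Pi.smul_apply, hneg, Pi.neg_apply, hBx, hRx, smul_eq_mul]
  by_cases hx : x ∈ Icc (-N) N <;> simp [hx]

theorem IsCutoffGreen.ne_zero {N : ℝ} {B : ℂ → L2 →L[ℂ] L2} (h : IsCutoffGreen b₁ b₂ x₂ k N B)
    (hx₀ : 0 < x₂) (hx₁ : x₂ < 1) (hk : 1 ≤ k) (hN₁ : 1 ≤ N) (hN : rightEnd x₂ k < N) (s : ℂ) :
    B s ≠ 0 := by
  have hend := rightEnd_pos hx₀ hk
  have hjost {y : ℝ} (hy : y ∈ Icc (-1 : ℝ) (-1 / 2)) :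
      jostL b₁ b₂ x₂ k s y = exp (s * b₁ * y) :=
    jostL_of_neg hx₀ hx₁ s (by linarith [hy.2])
  refine ne_zero_of_ae_eq_greenKernel (A := Icc (-N) N) (I := Ioo (rightEnd x₂ k) N)
    (J := Icc (-1) (-1 / 2))
    (fun x hx => ⟨by linarith [hx.1], hx.2.le⟩)
    (fun y hy => ⟨by linarith [hy.1], by linarith [hy.2]⟩) (by simpa using hN) (by norm_num)
    isCompact_Icc (fun x hx y hy => by linarith [hx.1, hy.2]) (fun x hx => ?_)
    (ContinuousOn.congr (by fun_prop) fun y hy => hjost hy) (fun y hy => ?_) (h s)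
  · rw [jostR_of_lt hx₀ hx₁ s hx.1]
    exact mul_ne_zero (exp_ne_zero _) (exp_ne_zero _)
  · rw [hjost hy]
    exact exp_ne_zero _

theorem exists_isCutoffResolventContinuation (hb₁ : 0 < b₁) (hb₂ : 0 < b₂) (hx₀ : 0 < x₂)
    (hx₁ : x₂ < 1) (hk : 1 ≤ k) (N : ℝ) : ∃ A, IsCutoffResolventContinuation b₁ b₂ x₂ k N A :=
  let ⟨_, hB, hBG⟩ := exists_differentiable_isCutoffGreen hb₁ hb₂ hx₀ hx₁ N
  ⟨_, hBG.isCutoffResolventContinuation hB hb₁ hb₂ hx₀ hx₁ hk⟩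

theorem IsCutoffResolventContinuation.eventuallyEq {N : ℝ} {A A' : ℂ → L2 →L[ℂ] L2}
    (h : IsCutoffResolventContinuation b₁ b₂ x₂ k N A)
    (h' : IsCutoffResolventContinuation b₁ b₂ x₂ k N A') (z : ℂ) : A =ᶠ[𝓝[≠] z] A' := by
  refine eventuallyEq_of_meromorphicOn h.1 h'.1 (w := I) ?_ z
  filter_upwards [(isOpen_lt continuous_const continuous_im).mem_nhds
    (show (0 : ℝ) < I.im by simp)] with w hw
  obtain ⟨R, hR, hA⟩ := h.2 w hw
  obtain ⟨R', hR', hA'⟩ := h'.2 w hw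
  rw [hA, hA', hR.unique hR']

theorem mem_resonances_iff (hb₁ : 0 < b₁) (hb₂ : 0 < b₂) (hx₀ : 0 < x₂) (hx₁ : x₂ < 1)
    (hk : 1 ≤ k) {z : ℂ} (hz : z.im < 0) :
    z ∈ resonances b₁ b₂ x₂ k ↔ detD b₁ b₂ x₂ (2 * k + 1) (-I * z) = 0 := by
  have hz₀ : z ≠ 0 := fun h => by simp [h] at hz
  have hW : Differentiable ℂ fun z => wronskian b₁ b₂ x₂ k (-I * z) :=
    (differentiable_wronskian hk).comp (by fun_prop)
  rw [← wronskian_eq_zero_iff hb₁ hb₂ (neg_I_mul_ne_zero hz₀)]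
  constructor
  · rintro ⟨-, N, A, hA, hord⟩
    by_contra hWz
    obtain ⟨B, hB, hBG⟩ := exists_differentiable_isCutoffGreen (k := k) hb₁ hb₂ hx₀ hx₁ N
    have hA' := hBG.isCutoffResolventContinuation hB hb₁ hb₂ hx₀ hx₁ hk
    have hB' : Differentiable ℂ fun z => -B (-I * z) := (hB.comp (by fun_prop)).neg
    rw [meromorphicOrderAt_congr (hA.eventuallyEq hA' z)] at hord
    exact hord.not_ge
      (((hW.analyticAt z).inv hWz).smul (hB'.analyticAt z)).meromorphicOrderAt_nonneg
  · intro hWz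
    obtain ⟨B, hB, hBG⟩ := exists_differentiable_isCutoffGreen (k := k) hb₁ hb₂ hx₀ hx₁ (k + 1)
    have hB' : Differentiable ℂ fun z => -B (-I * z) := (hB.comp (by fun_prop)).neg
    have hWI := wronskian_neg_I_mul_ne_zero hb₁ hb₂ hx₀ hx₁ hk (z := I) (by simp)
    have hBz : B (-I * z) ≠ 0 :=
      hBG.ne_zero hx₀ hx₁ hk (by simp) (by unfold rightEnd; linarith) _
    exact ⟨hz, k + 1, _, hBG.isCutoffResolventContinuation hB hb₁ hb₂ hx₀ hx₁ hk,
      meromorphicOrderAt_inv_smul_neg (hW.analyticAt z) (hB'.analyticAt z) hWz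
        (meromorphicOrderAt_ne_top_of_differentiable hW hWI z) (neg_ne_zero.2 hBz)⟩

end Continuation

/-! ### The reflection coefficient -/

section Reflection

variable {b₁ b₂ x₂ : ℝ} {k : ℕ}

theorem isReflectionCoefficient_I_mul_iff_exists_isSolution (hb₁ : 0 < b₁) (hb₂ : 0 < b₂)
    (s ρ : ℂ) :
    IsReflectionCoefficient b₁ b₂ x₂ k (I * s) ρ ↔
      ∃ ψ p τ, IsSolution (coeff b₁ b₂ x₂ k) s ψ p ∧
        (∀ y : ℝ, y < 0 → ψ y = exp (-s * b₁ * y) + ρ * exp (s * b₁ * y)) ∧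
        ∀ y : ℝ, k < y → ψ y = τ * exp (-s * b₁ * y) := by
  have ha : IsUniformlyElliptic (coeff b₁ b₂ x₂ k) _ _ := isUniformlyElliptic_coeff hb₁ hb₂
  have hI : I * (I * s) = -s := by rw [← mul_assoc, I_mul_I, neg_one_mul]
  have hsq (ζ : ℂ) : -((I * s) ^ 2 * ζ) = s ^ 2 * ζ := by simp [mul_pow]
  simp only [IsReflectionCoefficient, hI, hsq]
  constructor
  · rintro ⟨ψ, w, τ, hψ, hw, hleft, hright⟩
    obtain ⟨Ψ, P, hΨ, -, hsol⟩ := exists_isSolution_of_hasWeakDeriv ha.ne_zero hψ.2.2 hw.2.2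
    have heq {U : Set ℝ} (hU : IsOpen U) {g : ℝ → ℂ} (hg : Continuous g) (hψg : EqOn ψ g U) :
        EqOn Ψ g U := by
      refine Measure.eqOn_open_of_ae_eq (μ := volume) ?_ hU hsol.continuous.continuousOn
        hg.continuousOn
      filter_upwards [ae_restrict_of_ae hΨ, ae_restrict_mem hU.measurableSet] with y hy hyU
      rw [← hy, hψg hyU]
    exact ⟨Ψ, P, τ, hsol, heq isOpen_Iio (by fun_prop) fun y hy => (hleft y hy).trans (by ring_nf),
      heq isOpen_Ioi (by fun_prop) hright⟩
  · rintro ⟨ψ, p, τ, hsol, hleft, hright⟩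
    refine ⟨ψ, _, τ, hsol.hasH1LocDeriv ha.measurable ha.abs_inv_le, ?_,
      fun y hy => (hleft y hy).trans (by ring_nf), hright⟩
    simpa only [mul_inv_cancel_left₀ (ofReal_ne_zero.2 (ha.ne_zero _))]
      using hsol.hasH1LocDeriv_flux

theorem exp_coeffs_eq_zero {c A B : ℂ} (hc : c ≠ 0) {U : Set ℝ} (hU : IsOpen U)
    (hne : U.Nonempty) (h : ∀ y ∈ U, A * exp (c * y) + B * exp (-c * y) = 0) :
    A = 0 ∧ B = 0 := by
  obtain ⟨y, hy⟩ := hne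
  have hderiv :=
    ((hasDerivAt_exp_mul c y).const_mul A).add ((hasDerivAt_exp_mul (-c) y).const_mul B)
  have hzero : HasDerivAt (fun y : ℝ => A * exp (c * y) + B * exp (-c * y)) 0 y :=
    (hasDerivAt_const y (0 : ℂ)).congr_of_eventuallyEq (eventuallyEq_of_mem (hU.mem_nhds hy) h)
  have hsum := h y hy
  have hdiff : A * exp (c * y) - B * exp (-c * y) = 0 := by
    refine (mul_eq_zero.1 ?_).resolve_left hc
    linear_combination hderiv.unique hzero
  have hA : 2 * A * exp (c * y) = 0 := by linear_combination hsum + hdiff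
  have hB : 2 * B * exp (-c * y) = 0 := by linear_combination hsum - hdiff
  simpa [exp_ne_zero] using And.intro hA hB

theorem rightEnd_lt (hx₁ : x₂ < 1) : rightEnd x₂ k < k := by
  unfold rightEnd
  linarith

theorem exists_eq_const_mul_jostR (hb₁ : 0 < b₁) (hb₂ : 0 < b₂) (hx₀ : 0 < x₂) (hx₁ : x₂ < 1)
    (hk : 1 ≤ k) {s : ℂ} (hs : s ≠ 0) (hD : detD b₁ b₂ x₂ (2 * k + 1) s ≠ 0) {ψ p : ℝ → ℂ} {τ : ℂ}
    (h : IsSolution (coeff b₁ b₂ x₂ k) s ψ p)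
    (hright : ∀ y : ℝ, k < y → ψ y = τ * exp (-s * b₁ * y)) :
    ∃ β, ∀ y, ψ y = β * jostR b₁ b₂ x₂ k s y := by
  have hW : wronskian b₁ b₂ x₂ k s ≠ 0 := mt (wronskian_eq_zero_iff hb₁ hb₂ hs).1 hD
  obtain ⟨α, β, hαβ⟩ := h.exists_eq_linear_combination (isSolution_jostL hb₁ hb₂ hx₀ hx₁ s)
    (isSolution_jostR hb₁ hb₂ hx₀ hx₁ s) hW (wronskian_eq hb₁ hb₂ hx₀ hx₁ hk s)
  have hα : α * (rightNorm b₁ b₂ k * detD b₁ b₂ x₂ (2 * k + 1) s) = 0 := by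
    refine (exp_coeffs_eq_zero (mul_ne_zero hs (ofReal_ne_zero.2 hb₁.ne')) isOpen_Ioi
      (nonempty_Ioi (a := (k : ℝ))) (B := β * exp (s * b₁ * rightEnd x₂ k) - τ -
        α * (rightNorm b₁ b₂ k * detDtilde b₁ b₂ x₂ (2 * k + 1) s)) fun y hy => ?_).1
    have hend : rightEnd x₂ k < y := (rightEnd_lt hx₁).trans hy
    have hy' := hright y hy
    rw [hαβ y, jostL_of_le hk s hend.le, jostR_of_lt hx₀ hx₁ s hend, neg_mul s] at hy'
    linear_combination hy'
  have hα₀ : α = 0 :=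
    (mul_eq_zero.1 hα).resolve_right (mul_ne_zero (rightNorm_ne_zero hb₁ hb₂) hD)
  exact ⟨β, fun y => by rw [hαβ, hα₀, zero_mul, zero_add]⟩

variable (b₁ b₂ x₂ k) in
/-- The amplitude of the reflected wave relative to `det D_{2k+1}(s)`. -/
def reflectedAmplitude (s : ℂ) : ℂ :=
  -(exp (-2 * s * b₁ * rightEnd x₂ k) * detDtilde b₁ b₂ x₂ (2 * k + 1) s)

theorem jostR_of_neg_eq_reflectedAmplitude (hk : 1 ≤ k) (s : ℂ) {y : ℝ} (hy : y < 0) :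
    jostR b₁ b₂ x₂ k s y = rightNorm b₁ b₂ k * exp (s * b₁ * rightEnd x₂ k) *
      (detD b₁ b₂ x₂ (2 * k + 1) s * exp (-s * b₁ * y) +
        reflectedAmplitude b₁ b₂ x₂ k s * exp (s * b₁ * y)) := by
  have hexp : exp (-s * b₁ * rightEnd x₂ k) =
      exp (s * b₁ * rightEnd x₂ k) * exp (-2 * s * b₁ * rightEnd x₂ k) := by
    rw [← exp_add]
    congr 1
    ring
  rw [jostR_of_neg hk s hy, reflectedAmplitude, hexp]
  ring

theorem exists_isSolution_reflection_iff (hb₁ : 0 < b₁) (hb₂ : 0 < b₂) (hx₀ : 0 < x₂) (hx₁ : x₂ < 1)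
    (hk : 1 ≤ k) {s : ℂ} (hs : s ≠ 0) (hD : detD b₁ b₂ x₂ (2 * k + 1) s ≠ 0) (ρ : ℂ) :
    (∃ ψ p τ, IsSolution (coeff b₁ b₂ x₂ k) s ψ p ∧
      (∀ y : ℝ, y < 0 → ψ y = exp (-s * b₁ * y) + ρ * exp (s * b₁ * y)) ∧
      ∀ y : ℝ, k < y → ψ y = τ * exp (-s * b₁ * y)) ↔
    ρ = reflectedAmplitude b₁ b₂ x₂ k s / detD b₁ b₂ x₂ (2 * k + 1) s := by
  constructor
  · rintro ⟨ψ, p, τ, h, hleft, hright⟩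
    obtain ⟨β, hβ⟩ := exists_eq_const_mul_jostR hb₁ hb₂ hx₀ hx₁ hk hs hD h hright
    set γ := β * (rightNorm b₁ b₂ k * exp (s * b₁ * rightEnd x₂ k))
    obtain ⟨hρ, hone⟩ := exp_coeffs_eq_zero (mul_ne_zero hs (ofReal_ne_zero.2 hb₁.ne')) isOpen_Iio
      (nonempty_Iio (a := (0 : ℝ))) (A := γ * reflectedAmplitude b₁ b₂ x₂ k s - ρ)
      (B := γ * detD b₁ b₂ x₂ (2 * k + 1) s - 1) fun y hy => by
        have hy' := hleft y hy
        rw [hβ, jostR_of_neg_eq_reflectedAmplitude hk s hy, neg_mul s] at hy'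
        linear_combination hy'
    rw [eq_div_iff hD]
    linear_combination reflectedAmplitude b₁ b₂ x₂ k s * hone - detD b₁ b₂ x₂ (2 * k + 1) s * hρ
  · rintro rfl
    set c := (rightNorm b₁ b₂ k * exp (s * b₁ * rightEnd x₂ k) *
      detD b₁ b₂ x₂ (2 * k + 1) s)⁻¹ with hc
    refine ⟨_, _, c * exp (s * b₁ * rightEnd x₂ k),
      (isSolution_jostR hb₁ hb₂ hx₀ hx₁ s).const_mul c, fun y hy => ?_, fun y hy => ?_⟩
    · rw [jostR_of_neg_eq_reflectedAmplitude hk s hy, hc]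
      have hnorm : (rightNorm b₁ b₂ k : ℂ) ≠ 0 := rightNorm_ne_zero hb₁ hb₂
      field_simp
    · rw [jostR_of_lt hx₀ hx₁ s ((rightEnd_lt hx₁).trans hy), ← mul_assoc]

variable (b₁ b₂ x₂ k) in
/-- The meromorphic extension to `ℂ` of the reflection coefficient. -/
def reflection (z : ℂ) : ℂ :=
  reflectedAmplitude b₁ b₂ x₂ k (-I * z) / detD b₁ b₂ x₂ (2 * k + 1) (-I * z)

theorem isReflectionCoefficient_iff (hb₁ : 0 < b₁) (hb₂ : 0 < b₂) (hx₀ : 0 < x₂) (hx₁ : x₂ < 1)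
    (hk : 1 ≤ k) {z : ℂ} (hz : 0 ≤ z.im) (hz₀ : z ≠ 0) (ρ : ℂ) :
    IsReflectionCoefficient b₁ b₂ x₂ k z ρ ↔ ρ = reflection b₁ b₂ x₂ k z := by
  have hD : detD b₁ b₂ x₂ (2 * k + 1) (-I * z) ≠ 0 :=
    detD_ne_zero hb₁ hb₂ hx₀ hx₁ hk (by simpa using hz)
  have hzI : z = I * (-I * z) := by simp [← mul_assoc]
  rw [reflection, ← exists_isSolution_reflection_iff hb₁ hb₂ hx₀ hx₁ hk (neg_I_mul_ne_zero hz₀) hD,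
    ← isReflectionCoefficient_I_mul_iff_exists_isSolution hb₁ hb₂, ← hzI]

theorem differentiable_detD_neg_I_mul (hk : 1 ≤ k) :
    Differentiable ℂ fun z => detD b₁ b₂ x₂ (2 * k + 1) (-I * z) :=
  (differentiable_detD_detDtilde hk).1.comp (by fun_prop)

theorem differentiable_reflectedAmplitude_neg_I_mul (hk : 1 ≤ k) :
    Differentiable ℂ fun z => reflectedAmplitude b₁ b₂ x₂ k (-I * z) := by
  have h : Differentiable ℂ fun z => detDtilde b₁ b₂ x₂ (2 * k + 1) (-I * z) :=
    (differentiable_detD_detDtilde hk).2.comp (by fun_prop)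
  unfold reflectedAmplitude
  fun_prop

theorem analyticAt_reflection (hk : 1 ≤ k) {z : ℂ}
    (hz : detD b₁ b₂ x₂ (2 * k + 1) (-I * z) ≠ 0) : AnalyticAt ℂ (reflection b₁ b₂ x₂ k) z :=
  ((differentiable_reflectedAmplitude_neg_I_mul hk).analyticAt z).div
    ((differentiable_detD_neg_I_mul hk).analyticAt z) hz

theorem meromorphicOn_reflection (hk : 1 ≤ k) :
    MeromorphicOn (reflection b₁ b₂ x₂ k) univ := fun z _ =>
  ((differentiable_reflectedAmplitude_neg_I_mul hk).analyticAt z).meromorphicAt.div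
    ((differentiable_detD_neg_I_mul hk).analyticAt z).meromorphicAt

theorem meromorphicOrderAt_reflection_neg_iff (hb₁ : 0 < b₁) (hb₂ : 0 < b₂) (hx₀ : 0 < x₂)
    (hx₁ : x₂ < 1) (hk : 1 ≤ k) (z : ℂ) :
    meromorphicOrderAt (reflection b₁ b₂ x₂ k) z < 0 ↔
      detD b₁ b₂ x₂ (2 * k + 1) (-I * z) = 0 := by
  refine ⟨fun h => ?_, fun h => ?_⟩
  · by_contra hz
    exact h.not_ge (analyticAt_reflection hk hz).meromorphicOrderAt_nonneg
  · have hamp : reflectedAmplitude b₁ b₂ x₂ k (-I * z) ≠ 0 := neg_ne_zero.2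
      (mul_ne_zero (exp_ne_zero _) (detDtilde_ne_zero_of_detD_eq_zero hb₁ hb₂ hk h))
    have hdet := differentiable_detD_neg_I_mul (b₁ := b₁) (b₂ := b₂) (x₂ := x₂) hk
    have hI : detD b₁ b₂ x₂ (2 * k + 1) (-I * I) ≠ 0 :=
      detD_ne_zero hb₁ hb₂ hx₀ hx₁ hk (by simp)
    have hsmul : reflection b₁ b₂ x₂ k = fun z =>
        (detD b₁ b₂ x₂ (2 * k + 1) (-I * z))⁻¹ • reflectedAmplitude b₁ b₂ x₂ k (-I * z) :=
      funext fun z => div_eq_inv_mul _ _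
    rw [hsmul]
    exact meromorphicOrderAt_inv_smul_neg (hdet.analyticAt z)
      ((differentiable_reflectedAmplitude_neg_I_mul hk).analyticAt z) h
      (meromorphicOrderAt_ne_top_of_differentiable hdet hI z) hamp

theorem detD_two_mul_add_one (hk : 1 ≤ k) (s : ℂ) :
    detD b₁ b₂ x₂ (2 * k + 1) s = exp (-s * b₁ * rightEnd x₂ k) *
      ((b₂ - b₁) * exp (-s * b₂ * rightEnd x₂ k) * detDtilde b₁ b₂ x₂ (2 * k) s -
        (b₂ + b₁) * exp (s * b₂ * rightEnd x₂ k) * detD b₁ b₂ x₂ (2 * k) s) ∧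
    detDtilde b₁ b₂ x₂ (2 * k + 1) s = exp (s * b₁ * rightEnd x₂ k) *
      ((b₂ - b₁) * exp (s * b₂ * rightEnd x₂ k) * detD b₁ b₂ x₂ (2 * k) s -
        (b₂ + b₁) * exp (-s * b₂ * rightEnd x₂ k) * detDtilde b₁ b₂ x₂ (2 * k) s) := by
  obtain ⟨m, rfl⟩ := Nat.exists_eq_add_of_le' hk
  have hB : layerB b₁ b₂ (2 * m + 3) = b₁ := layerB_two_mul_add_one (m + 1)
  have hB' : layerB b₁ b₂ (2 * m + 2) = b₂ := layerB_two_mul (m + 1)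
  have hX : layerX x₂ (2 * m + 2) = rightEnd x₂ (m + 1) := layerX_two_mul (m + 1)
  rw [show 2 * (m + 1) + 1 = 2 * m + 3 by ring, show 2 * (m + 1) = 2 * m + 2 by ring]
  constructor <;> simp only [detD, detDtilde, detPair, hB, hB', hX]

theorem detDtilde_two_mul_ne_zero_of_detD_eq_zero (hb₁ : 0 < b₁) (hb₂ : 0 < b₂) (hk : 1 ≤ k) {s : ℂ}
    (h : detD b₁ b₂ x₂ (2 * k) s = 0) : detDtilde b₁ b₂ x₂ (2 * k) s ≠ 0 := by
  obtain ⟨m, rfl⟩ := Nat.exists_eq_add_of_le' hk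
  have hpair : layerPair (layerB b₁ b₂) (layerX x₂) s (2 * m + 1) =
      (detD b₁ b₂ x₂ (2 * (m + 1)) s, detDtilde b₁ b₂ x₂ (2 * (m + 1)) s) := by
    rfl
  intro h'
  refine layerPair_ne_zero (x := layerX x₂) s (layerB_pos hb₁ hb₂) (2 * m + 1) ?_
  rw [hpair, h, h', Prod.mk_zero_zero]

theorem detD_eq_Q (hb₁ : 0 < b₁) (hb₂ : 0 < b₂) (hk : 1 ≤ k) {s : ℂ}
    (hD : detD b₁ b₂ x₂ (2 * k) s ≠ 0) :
    detD b₁ b₂ x₂ (2 * k + 1) s = -((b₁ + b₂) * exp (s * b₂ * rightEnd x₂ k) *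
      detD b₁ b₂ x₂ (2 * k) s * exp (-s * b₁ * rightEnd x₂ k) *
      (1 - dCoeff b₁ b₂ * Q b₁ b₂ x₂ (2 * k) s)) ∧
    reflectedAmplitude b₁ b₂ x₂ k s = (b₁ + b₂) * exp (s * b₂ * rightEnd x₂ k) *
      detD b₁ b₂ x₂ (2 * k) s * exp (-s * b₁ * rightEnd x₂ k) *
      (-dCoeff b₁ b₂ + Q b₁ b₂ x₂ (2 * k) s) := by
  obtain ⟨hdet, hdet'⟩ := detD_two_mul_add_one (b₁ := b₁) (b₂ := b₂) (x₂ := x₂) hk s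
  have hb : (b₂ + b₁ : ℂ) ≠ 0 := by exact_mod_cast (add_pos hb₂ hb₁).ne'
  have hexp (b : ℂ) : exp (-2 * s * b * rightEnd x₂ k) =
      exp (-s * b * rightEnd x₂ k) / exp (s * b * rightEnd x₂ k) := by
    rw [← exp_sub]
    congr 1
    ring
  rw [reflectedAmplitude, hdet, hdet', Q, dCoeff, layerB_two_mul, layerX_two_mul, ← rightEnd, hexp,
    hexp]
  push_cast
  constructor <;> field_simp <;> ring

theorem reflection_eq (hb₁ : 0 < b₁) (hb₂ : 0 < b₂) (hk : 1 ≤ k) {z : ℂ}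
    (hD : detD b₁ b₂ x₂ (2 * k) (-I * z) ≠ 0) :
    reflection b₁ b₂ x₂ k z = -((-(dCoeff b₁ b₂ : ℂ) + Q b₁ b₂ x₂ (2 * k) (-I * z)) /
      (1 - (dCoeff b₁ b₂ : ℂ) * Q b₁ b₂ x₂ (2 * k) (-I * z))) := by
  have hb : (b₁ + b₂ : ℂ) ≠ 0 := by exact_mod_cast (add_pos hb₁ hb₂).ne'
  rw [reflection]
  generalize -I * z = s at *
  obtain ⟨hdet, hamp⟩ := detD_eq_Q hb₁ hb₂ hk hD
  rw [ hdet, hamp, div_neg, mul_div_mul_left]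
  exact mul_ne_zero (mul_ne_zero (mul_ne_zero hb (exp_ne_zero _)) hD) (exp_ne_zero _)

theorem detD_eq_zero_iff_Q (hb₁ : 0 < b₁) (hb₂ : 0 < b₂) (hk : 1 ≤ k) (hne : b₁ ≠ b₂) (s : ℂ) :
    detD b₁ b₂ x₂ (2 * k + 1) s = 0 ↔ detD b₁ b₂ x₂ (2 * k) s ≠ 0 ∧
      Q b₁ b₂ x₂ (2 * k) s = 1 / (dCoeff b₁ b₂ : ℂ) := by
  have hsub : (b₂ - b₁ : ℂ) ≠ 0 := by exact_mod_cast sub_ne_zero.2 hne.symm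
  have hb : (b₁ + b₂ : ℂ) ≠ 0 := by exact_mod_cast (add_pos hb₁ hb₂).ne'
  have hd : (dCoeff b₁ b₂ : ℂ) ≠ 0 := ofReal_ne_zero.2
    (div_ne_zero (sub_ne_zero.2 hne.symm) (add_pos hb₂ hb₁).ne')
  by_cases hD : detD b₁ b₂ x₂ (2 * k) s = 0
  · have hD' := detDtilde_two_mul_ne_zero_of_detD_eq_zero hb₁ hb₂ hk hD
    simp [(detD_two_mul_add_one hk s).1, hD, hD', hsub, exp_ne_zero]
  · simp only [(detD_eq_Q hb₁ hb₂ hk hD).1, mul_eq_zero, neg_eq_zero, hb, exp_ne_zero, hD, or_self,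
      false_or, sub_eq_zero, ne_eq, not_false_eq_true, true_and]
    rw [eq_div_iff hd, mul_comm, eq_comm]

end Reflection

end FinitePeriodic

end

theorem proposition5p2 (b₁ b₂ x₂ : ℝ) (hb₁ : 0 < b₁) (hb₂ : 0 < b₂) (hx₀ : 0 < x₂) (hx₁ : x₂ < 1)
    (k : ℕ) (hk : 1 ≤ k) :
    -- the resolvent of `P_k` has a meromorphic continuation, so that `Res(P_k)` is well defined
    (∀ N : ℝ, ∃ A : ℂ → FinitePeriodic.L2 →L[ℂ] FinitePeriodic.L2,
      FinitePeriodic.IsCutoffResolventContinuation b₁ b₂ x₂ k N A) ∧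
    -- `r` is the meromorphic extension of the reflection coefficient
    ∃ r : ℂ → ℂ, MeromorphicOn r Set.univ ∧
      (∀ z : ℂ, 0 ≤ z.im → z ≠ 0 → ∀ ρ : ℂ,
        FinitePeriodic.IsReflectionCoefficient b₁ b₂ x₂ k z ρ ↔ ρ = r z) ∧
      (∀ z : ℂ, 0 ≤ z.im → AnalyticAt ℂ r z) ∧
      -- its poles in the lower half-plane are exactly the resonances
      (∀ z : ℂ, z.im < 0 →
        (meromorphicOrderAt r z < 0 ↔ z ∈ FinitePeriodic.resonances b₁ b₂ x₂ k) ∧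
        (z ∉ FinitePeriodic.resonances b₁ b₂ x₂ k → AnalyticAt ℂ r z) ∧
        (z ∈ FinitePeriodic.resonances b₁ b₂ x₂ k ↔
          FinitePeriodic.detD b₁ b₂ x₂ (2 * k + 1) (-Complex.I * z) = 0) ∧
        (b₁ ≠ b₂ →
          (z ∈ FinitePeriodic.resonances b₁ b₂ x₂ k ↔
            FinitePeriodic.detD b₁ b₂ x₂ (2 * k) (-Complex.I * z) ≠ 0 ∧
            FinitePeriodic.Q b₁ b₂ x₂ (2 * k) (-Complex.I * z) =
              1 / (FinitePeriodic.dCoeff b₁ b₂ : ℂ)))) ∧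
      -- the linear fractional formula for `r`, wherever its right-hand side is defined
      (∀ z : ℂ, FinitePeriodic.detD b₁ b₂ x₂ (2 * k) (-Complex.I * z) ≠ 0 →
        1 - (FinitePeriodic.dCoeff b₁ b₂ : ℂ) *
          FinitePeriodic.Q b₁ b₂ x₂ (2 * k) (-Complex.I * z) ≠ 0 →
        r z = -((-(FinitePeriodic.dCoeff b₁ b₂ : ℂ) +
            FinitePeriodic.Q b₁ b₂ x₂ (2 * k) (-Complex.I * z)) /
          (1 - (FinitePeriodic.dCoeff b₁ b₂ : ℂ) *
            FinitePeriodic.Q b₁ b₂ x₂ (2 * k) (-Complex.I * z)))) := by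
  refine ⟨FinitePeriodic.exists_isCutoffResolventContinuation hb₁ hb₂ hx₀ hx₁ hk,
    FinitePeriodic.reflection b₁ b₂ x₂ k, FinitePeriodic.meromorphicOn_reflection hk,
    fun z hz hz₀ => FinitePeriodic.isReflectionCoefficient_iff hb₁ hb₂ hx₀ hx₁ hk hz hz₀,
    fun z hz => FinitePeriodic.analyticAt_reflection hk
      (FinitePeriodic.detD_ne_zero hb₁ hb₂ hx₀ hx₁ hk (by simpa using hz)),
    fun z hz => ?_, fun z hD _ => FinitePeriodic.reflection_eq hb₁ hb₂ hk hD⟩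
  have hres := FinitePeriodic.mem_resonances_iff hb₁ hb₂ hx₀ hx₁ hk hz
  refine ⟨?_, fun h => FinitePeriodic.analyticAt_reflection hk (mt hres.2 h), hres, fun hne => ?_⟩
  · rw [hres, FinitePeriodic.meromorphicOrderAt_reflection_neg_iff hb₁ hb₂ hx₀ hx₁ hk]
  · rw [hres, FinitePeriodic.detD_eq_zero_iff_Q hb₁ hb₂ hk hne]
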